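/- **Proposition (a variant of the Bak–Seeger restriction theorem).** For integrable $f$ on $\mathbb R^d$ put $\hat f(\xi)=\int e^{-ix\cdot\xi}f(x)\,dx$, and for a bounded complex Borel measure $\nu$ on $\mathbb R^d$ put $\hat\nu(\xi)=\int e^{-ix\cdot\xi}\,d\nu(x)$. Let $T_\nu$ be the convolution operator $T_\nu f=f*\hat\nu$. It is given by an absolutely convergent integral for $f\in L^1$, and "$\|T_\nu\|_{p\to q}\le B$" (for $p<\infty$) means that $T_\nu$, restricted to $L^1\cap L^p$, extends to a bounded linear operator from $L^p(\mathbb R^d)$ to $L^q(\mathbb R^d)$ of norm at most $B$. Let $d\ge 0$ and $N\ge 0$ be integers and $[\alpha,\beta]\subset\,]0,\infty[$ a compact interval. Then there is a constant $C>0$, depending only on $d$, $N$, $\alpha$ and $\beta$, such that the following holds. Let $\mu$ be a positive Borel measure on $\mathbb R^d$ of total mass at most $1$, let $p_0\in[1,2[$ with conjugate exponent $p_0'$, and suppose that $$\mu=\mu^b+\sum_{i=1}^N\mu^i$$ with bounded complex Borel measures $\mu^b,\mu^1,\dots,\mu^N$. Let $A\ge 0$ be a constant such that: (a) $\|T_{\mu^b}\|_{p_0\to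 p_0'}\le A$. (b) For each $i$ there are $K_i\in\mathbb N\cup\{\infty\}$ and integrable functions $\phi^i_j$ ($1\le j\le K_i$, $j<\infty$) with $\|\phi^i_j\|_1\le 1$ such that, with $\mu^i_j:=\mu*\phi^i_j$ (an absolutely continuous measure, identified with its density), $$\mu^i=\sum_{j=1}^{K_i}\mu^i_j,$$ where, if $K_i=\infty$, the partial sums converge in the sense of distributions; moreover there are $a_i,b_i\in[\alpha,\beta]$ such that for all $j$ $$\|\mu^i_j\|_\infty\le A\,2^{ja_i},\qquad \|\widehat{\mu^i_j}\|_\infty\le A\,2^{-jb_i},\qquad p_0=2\,\frac{a_i+b_i}{2a_i+b_i}.$$ Then for every $i$ $$\|T_{\mu^i}\|_{p_0\to p_0'}\le CA,$$ and $$\int|\hat f|^2\,d\mu\le CA\,\|f\|_{L^{p_0}(\mathbb R^d)}^2\qquad\text{for all } f\in L^{p_0}(\mathbb R^d),$$ the latter meaning that $f\mapsto\hat f$, defined on $L^1\cap L^{p_0}$, extends to a bounded linear operator from $L^{p_0}(\mathbb R^d)$ to $L^2(\mu)$ of norm at most $(CA)^{1/2}$. -/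

import Mathlib

open MeasureTheory Filter Topology
open scoped ENNReal ContDiff

noncomputable section

/-- The space `ℝ^d` with its Euclidean structure. -/
abbrev Rd (d : ℕ) : Type := EuclideanSpace ℝ (Fin d)

/-- The Fourier transform `f̂(ξ) = ∫ e^{-i x·ξ} f(x) dx` of an integrable function. -/
def fourierFun {d : ℕ} (f : Rd d → ℂ) (ξ : Rd d) : ℂ :=
  ∫ x, Complex.exp (-(Complex.I * ((inner ℝ x ξ : ℝ) : ℂ))) * f x

/-- The integral `∫ ψ dν` of a bounded continuous function against a bounded complex measure. -/
def integralCM {d : ℕ} (ν : ComplexMeasure (Rd d)) (ψ : Rd d → ℂ) : ℂ :=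
  ν.integral ψ (ContinuousLinearMap.mul ℝ ℂ)

/-- The Fourier transform `ν̂(ξ) = ∫ e^{-i x·ξ} dν(x)` of a bounded complex measure. -/
def fourierCM {d : ℕ} (ν : ComplexMeasure (Rd d)) (ξ : Rd d) : ℂ :=
  integralCM ν (fun x => Complex.exp (-(Complex.I * ((inner ℝ x ξ : ℝ) : ℂ))))

/-- The function `T_ν f = f * ν̂`, for integrable `f` (the integral converges absolutely at every
point, as `ν̂` is bounded and continuous). -/
def convOp {d : ℕ} (ν : ComplexMeasure (Rd d)) (f : Rd d → ℂ) (x : Rd d) : ℂ :=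
  ∫ y, f (x - y) * fourierCM ν y

/-- `T_ν` is bounded from `L^p` to `L^q` with operator norm at most `B`: there is a bounded linear
operator from `L^p` to `L^q` of norm at most `B` which agrees with `f ↦ f * ν̂` on `L^1 ∩ L^p`
(a dense subspace of `L^p` for finite `p`, so that the operator is unique). -/
def ConvBounded {d : ℕ} (ν : ComplexMeasure (Rd d)) (p q : ℝ≥0∞)
    [Fact (1 ≤ p)] [Fact (1 ≤ q)] (B : ℝ) : Prop :=
  ∃ S : Lp ℂ p (volume : Measure (Rd d)) →L[ℂ] Lp ℂ q (volume : Measure (Rd d)),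
    (∀ (f : Rd d → ℂ) (_ : MemLp f 1 volume) (hf : MemLp f p volume),
      (S (hf.toLp f) : Rd d → ℂ) =ᵐ[volume] convOp ν f) ∧
    ∀ g, ‖S g‖ ≤ B * ‖g‖

/-- The density `x ↦ ∫ φ(x - y) dμ(y)` of the absolutely continuous measure `μ * φ`, for `φ`
integrable and `μ` a finite measure. -/
def convDensity {d : ℕ} (μ : Measure (Rd d)) (φ : Rd d → ℂ) (x : Rd d) : ℂ :=
  ∫ y, φ (x - y) ∂μ

/-- `ν = ∑_{1 ≤ j ≤ K} g_j dx`, where `K` may be infinite: the partial sums converge to `ν` in the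
sense of distributions. (For finite `K` the partial sums are eventually constant, and this is
equality of the two measures.) -/
def IsDistribSum {d : ℕ} (ν : ComplexMeasure (Rd d)) (K : ℕ∞) (g : ℕ → Rd d → ℂ) : Prop :=
  ∀ ψ : Rd d → ℂ, ContDiff ℝ ∞ ψ → HasCompactSupport ψ →
    Tendsto (fun n : ℕ => ∑ j ∈ (Finset.Icc 1 n).filter (fun j : ℕ => (j : ℕ∞) ≤ K),
      ∫ x, ψ x * g j x) atTop (𝓝 (integralCM ν ψ))

end

/-! ### Complex measures and their Fourier transforms. -/

open scoped ComplexConjugate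

/-! Everything is expressed by the sesquilinear form with kernel `ν̂(y - x)`. An `L^p × L^p` bound
for it is dual to the `L^p → L^{p'}` bound for `T_ν` (`ConvBounded.norm_form_le`,
`convBounded_of_norm_form_le`), and for `ν = μ` its diagonal is `∫ |f̂|² dμ`
(`form_fourier_measure`).

The proof is a bootstrap. Let `M ≥ A` satisfy `∫ |ĝ|² dμ ≤ M ‖g‖_p²` for test functions `g`
supported in a fixed set `E` of finite measure; some `M` exists by Hölder, but it depends on `E`.
The form of the piece `μ_j = μ * φ_j` then has three bounds. The Fourier decay gives `L¹ × L¹` with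
constant `A 2^{-jb}`. Cauchy–Schwarz in `L²(|μ_j|)` gives `L² × L^p` and `L^p × L²` with constant
`√((2π)^d A M) 2^{ja/2}`: one factor is handled by Plancherel and the sup bound, the other by `M`,
because a restriction bound survives averaging over translates (`IsRestrictionBound.convolve`).

Now cut `f` and `g` into level sets of height `2^{σl}` and `2^{σl'}`. For the given `p` there is a
`σ` for which the three bounds depend only on `m = j + l` and `n = j + l'`, and their minimum decays
exponentially in `|m| + |n|` (`le_two_rpow_neg_abs`). A Schur-type estimate (`sum_schur_le`) sums
over all `j`, `l`, `l'` without loss, so the form of each `μ^i` is at most `c √(AM) ‖f‖_p ‖g‖_p`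
(`IsDyadicSum.norm_form_le`).

Adding up the pieces, `A + N c √(AM)` is again an admissible constant. For the least `M` this forces
`M ≤ (2 + (Nc)²) A` (`IsRestrictionBound.absorb`), where `E` no longer enters. Inserting this `M`
into the bound for `μ^i` gives the claim on `T_{μ^i}`; truncation and density remove the test
functions. -/

theorem enorm_ofReal (x : ℝ) : ‖(x : ℂ)‖ₑ = ‖x‖ₑ := by
  rw [← ofReal_norm, ← ofReal_norm, Complex.norm_real]

/-- The total variations of the real and imaginary parts are finite and together dominate `|ν(s)|`.
This makes bounded measurable functions, in particular characters, integrable against every complex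
measure. -/
instance ComplexMeasure.isFiniteMeasure_variation {X : Type*} [MeasurableSpace X]
    (ν : ComplexMeasure X) : IsFiniteMeasure ν.variation := by
  refine isFiniteMeasure_of_le
    ((ComplexMeasure.re ν).totalVariation + (ComplexMeasure.im ν).totalVariation) ?_
  refine VectorMeasure.variation_le_of_forall_enorm_le fun s _ => ?_
  rw [Measure.add_apply]
  refine le_trans ?_ (add_le_add (SignedMeasure.enorm_le_totalVariation _ s)
    (SignedMeasure.enorm_le_totalVariation _ s))
  have h1 : (ComplexMeasure.re ν) s = (ν s).re := rfl
  have h2 : (ComplexMeasure.im ν) s = (ν s).im := rfl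
  rw [h1, h2]
  conv_lhs => rw [← Complex.re_add_im (ν s)]
  refine (enorm_add_le _ _).trans ?_
  rw [enorm_mul, enorm_ofReal, enorm_ofReal, ← ofReal_norm Complex.I, Complex.norm_I]
  simp

/-- The character `x ↦ e^{-i x·ξ}`. -/
noncomputable def eChar {d : ℕ} (ξ x : Rd d) : ℂ :=
  Complex.exp (-(Complex.I * ((inner ℝ x ξ : ℝ) : ℂ)))

theorem norm_eChar {d : ℕ} (ξ x : Rd d) : ‖eChar ξ x‖ = 1 := by
  rw [eChar, Complex.norm_exp]; simp

theorem continuous_eChar {d : ℕ} : Continuous fun p : Rd d × Rd d => eChar p.1 p.2 := by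
  unfold eChar; fun_prop

theorem fourierFun_eq {d : ℕ} (f : Rd d → ℂ) (ξ : Rd d) :
    fourierFun f ξ = ∫ x, eChar ξ x * f x := rfl

theorem fourierCM_eq {d : ℕ} (ν : ComplexMeasure (Rd d)) (ξ : Rd d) :
    fourierCM ν ξ = integralCM ν (eChar ξ) := rfl

theorem continuous_fourierCM {d : ℕ} (ν : ComplexMeasure (Rd d)) : Continuous (fourierCM ν) := by
  refine VectorMeasure.continuous_of_dominated (bound := fun _ => 1) (fun ξ => ?_) (fun ξ => ?_)
    (integrable_const _) ?_
  · exact (continuous_eChar.comp (Continuous.prodMk_right ξ)).aestronglyMeasurable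
  · exact Eventually.of_forall fun x => (norm_eChar ξ x).le
  · exact Eventually.of_forall fun x => continuous_eChar.comp (Continuous.prodMk_left x)

theorem exists_norm_fourierCM_le {d : ℕ} (ν : ComplexMeasure (Rd d)) :
    ∃ c : ℝ, ∀ ξ, ‖fourierCM ν ξ‖ ≤ c :=
  ⟨_, fun ξ => VectorMeasure.norm_integral_le_of_norm_le_const
    (Eventually.of_forall fun x => (norm_eChar ξ x).le)⟩

theorem integralCM_of_measure {d : ℕ} (μ : Measure (Rd d)) [IsFiniteMeasure μ]
    (ν : ComplexMeasure (Rd d)) (h : ∀ s, MeasurableSet s → ((μ s).toReal : ℂ) = ν s)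
    {ψ : Rd d → ℂ} (hψ : Integrable ψ μ) : integralCM ν ψ = ∫ x, ψ x ∂μ := by
  have hle : ν.variation ≤ μ := by
    refine VectorMeasure.variation_le_of_forall_enorm_le fun s hs => ?_
    rw [← h s hs, enorm_ofReal, Real.enorm_of_nonneg ENNReal.toReal_nonneg,
      ENNReal.ofReal_toReal (measure_ne_top _ _)]
  rw [integralCM, VectorMeasure.integral_eq_setToFun, integral_eq_setToFun]
  have key : ∀ s, MeasurableSet s →
      ν.transpose (ContinuousLinearMap.mul ℝ ℂ) s = weightedSMul (F := ℂ) μ s := by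
    intro s hs
    ext1 x
    rw [MeasureTheory.transpose_eq_cbmApplyMeasure, cbmApplyMeasure_apply, weightedSMul_apply,
      ContinuousLinearMap.mul_apply', ← h s hs, mul_comm, Complex.real_smul]
    rfl
  have hT : DominatedFinMeasAdditive μ (ν.transpose (ContinuousLinearMap.mul ℝ ℂ)) 1 := by
    have hw := dominatedFinMeasAdditive_weightedSMul (F := ℂ) μ
    refine ⟨fun s t hs ht h1 h2 hd => ?_, fun s hs h1 => ?_⟩
    · rw [key _ (hs.union ht), key s hs, key t ht]; exact hw.1 s t hs ht h1 h2 hd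
    · rw [key s hs]; exact hw.2 s hs h1
  -- The two integrals extend the same set function but with different dominating measures; change
  -- the measure first, then the set function.
  rw [← setToFun_congr_measure_of_integrable 1 ENNReal.one_ne_top (by rwa [one_smul]) hT _ ψ hψ]
  exact setToFun_congr_left' _ _ (fun s hs _ => key s hs) ψ

theorem fourierCM_decomp {d N : ℕ} (μ : Measure (Rd d)) [IsFiniteMeasure μ]
    (μb : ComplexMeasure (Rd d)) (μi : Fin N → ComplexMeasure (Rd d))
    (h : ∀ s : Set (Rd d), MeasurableSet s → ((μ s).toReal : ℂ) = μb s + ∑ i, μi i s)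
    (ξ : Rd d) : ∫ x, eChar ξ x ∂μ = fourierCM μb ξ + ∑ i, fourierCM (μi i) ξ := by
  have hint : ∀ (ρ : Measure (Rd d)) [IsFiniteMeasure ρ], Integrable (eChar ξ) ρ := fun ρ _ =>
    (integrable_const (1 : ℝ)).mono'
      (continuous_eChar.comp (Continuous.prodMk_right ξ)).aestronglyMeasurable
      (Eventually.of_forall fun x => (norm_eChar ξ x).le)
  rw [← integralCM_of_measure μ (μb + ∑ i, μi i) (fun s hs => by rw [h s hs]; simp) (hint μ)]
  simp only [fourierCM_eq, integralCM]
  rw [VectorMeasure.integral_add_vectorMeasure (hint _)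
    (VectorMeasure.Integrable.finsetSum_vectorMeasure fun i _ => hint _),
    VectorMeasure.integral_finsetSum_vectorMeasure fun i _ => hint _]

/-! ### Sesquilinear forms with a convolution kernel. -/

/-- The Fourier transform of the (complex) measure `m ρ`. -/
noncomputable def hatOf {d : ℕ} (ρ : Measure (Rd d)) (m : Rd d → ℂ) (ξ : Rd d) : ℂ :=
  ∫ x, eChar ξ x * m x ∂ρ

/-- The sesquilinear form with convolution kernel `k`. -/
noncomputable def form {d : ℕ} (k f g : Rd d → ℂ) : ℂ :=
  ∫ p : Rd d × Rd d, conj (f p.1) * g p.2 * k (p.2 - p.1)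

section
variable {d : ℕ}

theorem integrable_eChar_mul {ρ : Measure (Rd d)} {m : Rd d → ℂ} (hm : Integrable m ρ)
    (ξ : Rd d) : Integrable (fun x => eChar ξ x * m x) ρ :=
  hm.bdd_mul (c := 1) (continuous_eChar.comp (Continuous.prodMk_right ξ)).aestronglyMeasurable
    (Eventually.of_forall fun x => (norm_eChar ξ x).le)

theorem continuous_hatOf {ρ : Measure (Rd d)} {m : Rd d → ℂ} (hm : Integrable m ρ) :
    Continuous (hatOf ρ m) := by
  refine continuous_of_dominated (bound := fun x => ‖m x‖)
    (fun ξ => (integrable_eChar_mul hm ξ).aestronglyMeasurable) (fun ξ => ?_) hm.norm ?_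
  · exact Eventually.of_forall fun x => by rw [norm_mul, norm_eChar, one_mul]
  · exact Eventually.of_forall fun x =>
      (continuous_eChar.comp (Continuous.prodMk_left x)).mul continuous_const

theorem norm_hatOf_le (ρ : Measure (Rd d)) (m : Rd d → ℂ) (ξ : Rd d) :
    ‖hatOf ρ m ξ‖ ≤ ∫ x, ‖m x‖ ∂ρ := by
  refine (norm_integral_le_integral_norm _).trans (le_of_eq ?_)
  simp [norm_eChar]

theorem integrable_conj {f : Rd d → ℂ} (hf : Integrable f) :
    Integrable (fun x => conj (f x)) :=
  hf.congr' (Complex.continuous_conj.comp_aestronglyMeasurable hf.aestronglyMeasurable)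
    (Eventually.of_forall fun x => by simp)

theorem integrable_form {k f g : Rd d → ℂ} {c : ℝ} (hk : Continuous k) (hc : ∀ x, ‖k x‖ ≤ c)
    (hf : Integrable f) (hg : Integrable g) :
    Integrable (fun p : Rd d × Rd d => conj (f p.1) * g p.2 * k (p.2 - p.1)) :=
  ((integrable_conj hf).mul_prod hg).mul_bdd (c := c)
    (hk.comp (continuous_snd.sub continuous_fst)).aestronglyMeasurable
    (Eventually.of_forall fun _ => hc _)

theorem norm_form_le {k f g : Rd d → ℂ} {c : ℝ} (hc : ∀ x, ‖k x‖ ≤ c)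
    (hf : Integrable f) (hg : Integrable g) :
    ‖form k f g‖ ≤ c * (∫ x, ‖f x‖) * ∫ x, ‖g x‖ := by
  calc ‖form k f g‖ ≤ ∫ p : Rd d × Rd d, c * (‖f p.1‖ * ‖g p.2‖) := by
        refine norm_integral_le_of_norm_le ((hf.norm.mul_prod hg.norm).const_mul c)
          (Eventually.of_forall fun p => ?_)
        rw [norm_mul, norm_mul, RCLike.norm_conj, mul_comm]
        gcongr
        exact hc _
    _ = c * (∫ x, ‖f x‖) * ∫ x, ‖g x‖ := by
        rw [integral_const_mul, Measure.volume_eq_prod,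
          integral_prod_mul (fun x => ‖f x‖) (fun x => ‖g x‖), mul_assoc]

theorem form_sum_left {ι : Type*} (s : Finset ι) {k g : Rd d → ℂ} {F : ι → Rd d → ℂ} {c : ℝ}
    (hk : Continuous k) (hc : ∀ x, ‖k x‖ ≤ c) (hF : ∀ i ∈ s, Integrable (F i))
    (hg : Integrable g) :
    form k (fun x => ∑ i ∈ s, F i x) g = ∑ i ∈ s, form k (F i) g := by
  simp only [form, map_sum, Finset.sum_mul]
  exact integral_finsetSum _ fun i hi => integrable_form hk hc (hF i hi) hg

theorem form_sum_right {ι : Type*} (s : Finset ι) {k f : Rd d → ℂ} {G : ι → Rd d → ℂ} {c : ℝ}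
    (hk : Continuous k) (hc : ∀ x, ‖k x‖ ≤ c) (hf : Integrable f)
    (hG : ∀ i ∈ s, Integrable (G i)) :
    form k f (fun x => ∑ i ∈ s, G i x) = ∑ i ∈ s, form k f (G i) := by
  simp only [form, Finset.mul_sum, Finset.sum_mul]
  exact integral_finsetSum _ fun i hi => integrable_form hk hc hf (hG i hi)

theorem form_smul (k f g : Rd d → ℂ) (a b : ℝ) :
    form k (fun x => (a : ℂ) * f x) (fun x => (b : ℂ) * g x) = (a : ℂ) * b * form k f g := by
  rw [form, form, ← integral_const_mul]
  congr 1; ext p; simp; ring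

theorem form_add_kernel {ι : Type*} (s : Finset ι) {k₀ : Rd d → ℂ} {k : ι → Rd d → ℂ}
    {f g : Rd d → ℂ} {c₀ : ℝ} {c : ι → ℝ} (hk₀ : Continuous k₀) (hc₀ : ∀ x, ‖k₀ x‖ ≤ c₀)
    (hk : ∀ i, Continuous (k i)) (hc : ∀ i x, ‖k i x‖ ≤ c i)
    (hf : Integrable f) (hg : Integrable g) :
    form (fun x => k₀ x + ∑ i ∈ s, k i x) f g = form k₀ f g + ∑ i ∈ s, form (k i) f g := by
  simp only [form, mul_add, Finset.mul_sum]
  rw [integral_add (integrable_form hk₀ hc₀ hf hg)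
    (integrable_finsetSum _ fun i _ => integrable_form (hk i) (hc i) hf hg),
    integral_finsetSum _ fun i _ => integrable_form (hk i) (hc i) hf hg]

theorem hasSum_form {k : ℕ → Rd d → ℂ} {K f g : Rd d → ℂ} {c : ℕ → ℝ}
    (hk : ∀ j, Continuous (k j)) (hc : ∀ j x, ‖k j x‖ ≤ c j) (hs : Summable c)
    (hK : ∀ x, HasSum (fun j => k j x) (K x)) (hf : Integrable f) (hg : Integrable g) :
    HasSum (fun j => form (k j) f g) (form K f g) := by
  have hfg : Integrable (fun p : Rd d × Rd d => ‖f p.1‖ * ‖g p.2‖) := hf.norm.mul_prod hg.norm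
  refine hasSum_integral_of_dominated_convergence
    (fun j p => c j * (‖f p.1‖ * ‖g p.2‖)) (fun j => (integrable_form (hk j) (hc j) hf hg).1)
    (fun j => Eventually.of_forall fun p => ?_) (Eventually.of_forall fun p => hs.mul_right _) ?_
    (Eventually.of_forall fun p => (hK _).mul_left _)
  · rw [norm_mul, norm_mul, RCLike.norm_conj, mul_comm]
    gcongr
    exact hc _ _
  · simp only [tsum_mul_right]
    exact hfg.const_mul _

/-- Fubini and the reflection `x ↦ y - x`. The conjugate on `f` matches the convention in `form`,
which is chosen so that the diagonal form of `μ̂` is nonnegative. -/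
theorem integral_convOp_mul (ν : ComplexMeasure (Rd d)) {f g : Rd d → ℂ} (hf : Integrable f)
    (hg : Integrable g) :
    ∫ y, convOp ν (fun x => conj (f x)) y * g y = form (fourierCM ν) f g := by
  obtain ⟨c, hc⟩ := exists_norm_fourierCM_le ν
  rw [form, Measure.volume_eq_prod, integral_prod_symm _
    (by rw [← Measure.volume_eq_prod]; exact integrable_form (continuous_fourierCM ν) hc hf hg)]
  congr 1; ext y
  rw [convOp, ← integral_mul_const, ← integral_sub_left_eq_self _ volume y]
  congr 1; ext x
  simp only [sub_sub_cancel]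
  ring

/-- Fubini, since the character splits as `e^{-i(y-x)·ξ} = conj(e^{-ix·ξ}) e^{-iy·ξ}`. -/
theorem form_hatOf {ρ : Measure (Rd d)} [SFinite ρ] {m f g : Rd d → ℂ} (hm : Integrable m ρ)
    (hf : Integrable f) (hg : Integrable g) :
    form (hatOf ρ m) f g = ∫ ξ, conj (fourierFun f ξ) * fourierFun g ξ * m ξ ∂ρ := by
  have hint : Integrable (fun q : (Rd d × Rd d) × Rd d =>
      (conj (f q.1.1) * g q.1.2 * m q.2) * eChar (q.1.2 - q.1.1) q.2)
      ((volume : Measure (Rd d × Rd d)).prod ρ) := by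
    refine (((integrable_conj hf).mul_prod hg).mul_prod hm).mul_bdd (c := 1) ?_
      (Eventually.of_forall fun _ => (norm_eChar _ _).le)
    exact (continuous_eChar.comp (by fun_prop : Continuous fun q : (Rd d × Rd d) × Rd d =>
      (q.1.2 - q.1.1, q.2))).aestronglyMeasurable
  calc form (hatOf ρ m) f g
      = ∫ p : Rd d × Rd d, ∫ ξ, (conj (f p.1) * g p.2 * m ξ) * eChar (p.2 - p.1) ξ ∂ρ := by
        rw [form]; congr 1; ext p
        rw [hatOf, ← integral_const_mul]
        congr 1; ext ξ; ring
    _ = ∫ ξ, (∫ p : Rd d × Rd d, (conj (f p.1) * g p.2 * m ξ) * eChar (p.2 - p.1) ξ) ∂ρ :=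
        integral_integral_swap hint
    _ = _ := by
        congr 1; ext ξ
        have : ∀ p : Rd d × Rd d, (conj (f p.1) * g p.2 * m ξ) * eChar (p.2 - p.1) ξ
            = (conj (eChar ξ p.1 * f p.1) * (eChar ξ p.2 * g p.2)) * m ξ := by
          intro p
          have h1 : eChar (p.2 - p.1) ξ = conj (eChar ξ p.1) * eChar ξ p.2 := by
            simp only [eChar, ← Complex.exp_conj, ← Complex.exp_add, inner_sub_right]
            congr 1
            simp only [map_neg, map_mul, Complex.conj_I, Complex.conj_ofReal,
              real_inner_comm ξ]
            push_cast
            ring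
          rw [h1, map_mul]; ring
        simp only [this]
        rw [integral_mul_const, Measure.volume_eq_prod,
          integral_prod_mul (fun x => conj (eChar ξ x * f x)) (fun y => eChar ξ y * g y),
          integral_conj]
        rfl

end

/-! ### Parseval, Plancherel, and Fourier transforms of distributional sums. -/

section
variable {d : ℕ}
open FourierTransform

theorem fourierFun_smul_two_pi (f : Rd d → ℂ) (w : Rd d) :
    fourierFun f ((2 * Real.pi) • w) = 𝓕 f w := by
  rw [Real.fourier_eq', fourierFun]
  congr 1; ext x
  rw [smul_eq_mul, inner_smul_right]
  congr 2
  push_cast; ring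

theorem eChar_add (ξ η x : Rd d) : eChar (ξ + η) x = eChar ξ x * eChar η x := by
  rw [eChar, eChar, eChar, ← Complex.exp_add, inner_add_right]
  congr 1; push_cast; ring

theorem eChar_smul (c : ℝ) (ξ x : Rd d) : eChar (c • ξ) x = eChar ξ (c • x) := by
  rw [eChar, eChar, inner_smul_right, inner_smul_left]; simp

theorem eChar_comm (ξ x : Rd d) : eChar ξ x = eChar x ξ := by
  rw [eChar, eChar, real_inner_comm]

/-- Parseval's formula for the test functions `x ↦ ψ (c x) e^{-i x·ξ}` with `ψ` the Fourier
transform of `χ`. -/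
theorem integral_fourierFun_smul_mul {χ m : Rd d → ℂ} (hχ : Integrable χ) (hm : Integrable m)
    (c : ℝ) (ξ : Rd d) :
    ∫ x, (fourierFun χ (c • x) * eChar ξ x) * m x = ∫ y, χ y * fourierFun m (ξ + c • y) := by
  have hint : Integrable (fun q : Rd d × Rd d => (m q.1 * χ q.2) * eChar (ξ + c • q.2) q.1) :=
    (hm.mul_prod hχ).mul_bdd (c := 1) (continuous_eChar.comp
      (by fun_prop : Continuous fun q : Rd d × Rd d => (ξ + c • q.2, q.1))).aestronglyMeasurable
      (Eventually.of_forall fun _ => (norm_eChar _ _).le)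
  calc ∫ x, (fourierFun χ (c • x) * eChar ξ x) * m x
      = ∫ x, ∫ y, (m x * χ y) * eChar (ξ + c • y) x := by
        congr 1; ext x
        rw [fourierFun_eq, mul_assoc, ← integral_mul_const]
        congr 1; ext y
        rw [eChar_add, eChar_smul, eChar_comm x, eChar_smul]; ring
    _ = ∫ y, ∫ x, (m x * χ y) * eChar (ξ + c • y) x := integral_integral_swap hint
    _ = _ := by
        congr 1; ext y
        rw [fourierFun_eq, ← integral_const_mul]
        congr 1; ext x; ring

/-- If the densities `m j` add up to `ν` as distributions and their Fourier transforms are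
bounded by a summable sequence, then the Fourier transforms add up pointwise. -/
theorem hasSum_fourierCM (ν : ComplexMeasure (Rd d)) {m : ℕ → Rd d → ℂ} {c : ℕ → ℝ}
    (hm : ∀ j, Integrable (m j)) (hs : Summable c) (hc : ∀ j ξ, ‖fourierFun (m j) ξ‖ ≤ c j)
    (hd : ∀ ψ : Rd d → ℂ, ContDiff ℝ ∞ ψ → HasCompactSupport ψ →
      Tendsto (fun n : ℕ => ∑ j ∈ Finset.range (n + 1), ∫ x, ψ x * m j x) atTop
        (𝓝 (integralCM ν ψ)))
    (ξ : Rd d) : HasSum (fun j => fourierFun (m j) ξ) (fourierCM ν ξ) := by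
  have hsum : Summable (fun j => fourierFun (m j) ξ) := Summable.of_norm_bounded hs (hc · ξ)
  let b : ContDiffBump (0 : Rd d) := default
  let ψ : Rd d → ℂ := fun x => (b x : ℂ)
  have hψ : ContDiff ℝ ∞ ψ := Complex.ofRealCLM.contDiff.comp b.contDiff
  have hψc : HasCompactSupport ψ := b.hasCompactSupport.comp_left Complex.ofReal_zero
  have hψ0 : ψ 0 = 1 := by
    have : b 0 = 1 := b.one_of_mem_closedBall (Metric.mem_closedBall_self b.rIn_pos.le)
    simp [ψ, this]
  have hψ1 : ∀ x, ‖ψ x‖ ≤ 1 := fun x => by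
    simp only [ψ, Complex.norm_real, Real.norm_of_nonneg b.nonneg]; exact b.le_one
  -- Writing the cutoff as a Fourier transform turns its pairing with `m j` into an average of the
  -- Fourier transform of `m j` against the integrable function `χ`.
  let Ψ : SchwartzMap (Rd d) ℂ := hψc.toSchwartzMap hψ
  let χ : SchwartzMap (Rd d) ℂ := 𝓕⁻ Ψ
  have hχ : ∀ x, fourierFun χ ((2 * Real.pi) • x) = ψ x := fun x => by
    rw [fourierFun_smul_two_pi, ← SchwartzMap.fourier_coe]
    have : 𝓕 χ = Ψ := FourierTransform.fourier_fourierInv_eq Ψ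
    rw [this]; rfl
  have hχi : Integrable χ := χ.integrable
  let r : ℕ → ℝ := fun n => ((n : ℝ) + 1)⁻¹
  have hr : Tendsto r atTop (𝓝 0) := by
    simpa [r, one_div] using tendsto_one_div_add_atTop_nhds_zero_nat (𝕜 := ℝ)
  have hrpos : ∀ n, r n ≠ 0 := fun n => by positivity
  -- Characters are not compactly supported, so they are approximated by dilated cutoffs times the
  -- character.
  let Φ : ℕ → Rd d → ℂ := fun n x => ψ (r n • x) * eChar ξ x
  have hΦs : ∀ n, ContDiff ℝ ∞ (Φ n) := fun n => by
    refine (hψ.comp (contDiff_const_smul (r n))).mul ?_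
    unfold eChar
    refine Complex.contDiff_exp.comp (contDiff_const.mul ?_).neg
    exact Complex.ofRealCLM.contDiff.comp (contDiff_id.inner ℝ contDiff_const)
  have hΦc : ∀ n, HasCompactSupport (Φ n) := fun n =>
    (hψc.comp_smul (hrpos n)).mul_right
  have hΦ1 : ∀ n x, ‖Φ n x‖ ≤ 1 := fun n x => by
    simp only [Φ, norm_mul, norm_eChar, mul_one]; exact hψ1 _
  have hΦlim : ∀ x, Tendsto (fun n => Φ n x) atTop (𝓝 (eChar ξ x)) := fun x => by
    have h1 : Tendsto (fun n => r n • x) atTop (𝓝 0) := by simpa using hr.smul_const x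
    have h2 := (hψ.continuous.tendsto 0).comp h1
    rw [hψ0] at h2
    simpa [Φ] using h2.mul_const (eChar ξ x)
  have hΦint : ∀ n j, ∫ x, Φ n x * m j x
      = ∫ y, χ y * fourierFun (m j) (ξ + (2 * Real.pi * r n) • y) := fun n j => by
    rw [← integral_fourierFun_smul_mul hχi (hm j)]
    congr 1; ext x
    rw [mul_smul, hχ]
  -- This bound does not depend on `n` and is summable in `j`, which justifies exchanging the limit
  -- in `n` with the sum over `j`.
  have hbound : ∀ n j, ‖∫ x, Φ n x * m j x‖ ≤ (∫ y, ‖χ y‖) * c j := fun n j => by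
    rw [hΦint, ← integral_mul_const]
    refine norm_integral_le_of_norm_le (hχi.norm.mul_const _) (Eventually.of_forall fun y => ?_)
    rw [norm_mul]
    gcongr
    exact hc _ _
  have hΦν : ∀ n, integralCM ν (Φ n) = ∑' j, ∫ x, Φ n x * m j x := fun n => by
    have h1 : Summable (fun j => ∫ x, Φ n x * m j x) :=
      Summable.of_norm_bounded (hs.mul_left _) (hbound n)
    exact tendsto_nhds_unique (hd _ (hΦs n) (hΦc n))
      (h1.hasSum.tendsto_sum_nat.comp (tendsto_add_atTop_nat 1))
  have hL : Tendsto (fun n => integralCM ν (Φ n)) atTop (𝓝 (fourierCM ν ξ)) :=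
    VectorMeasure.tendsto_integral_of_dominated_convergence (fun _ => 1)
      (fun n => (hΦs n).continuous.aestronglyMeasurable) (integrable_const _)
      (fun n => Eventually.of_forall (hΦ1 n)) (Eventually.of_forall hΦlim)
  have hR : Tendsto (fun n => ∑' j, ∫ x, Φ n x * m j x) atTop
      (𝓝 (∑' j, fourierFun (m j) ξ)) := by
    refine tendsto_tsum_of_dominated_convergence (hs.mul_left (∫ y, ‖χ y‖)) (fun j => ?_)
      (Eventually.of_forall hbound)
    refine tendsto_integral_of_dominated_convergence (fun x => ‖m j x‖)
      (fun n => ?_) (hm j).norm (fun n => Eventually.of_forall fun x => ?_)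
      (Eventually.of_forall fun x => (hΦlim x).mul_const _)
    · exact (hΦs n).continuous.aestronglyMeasurable.mul (hm j).1
    · rw [norm_mul]; exact mul_le_of_le_one_left (norm_nonneg _) (hΦ1 n x)
  rw [show fourierCM ν ξ = ∑' j, fourierFun (m j) ξ from
    tendsto_nhds_unique hL (by simpa only [hΦν] using hR)]
  exact hsum.hasSum

theorem continuous_fourierFun {f : Rd d → ℂ} (hf : Integrable f) : Continuous (fourierFun f) :=
  continuous_hatOf hf

/-- The `L²` Fourier transform agrees with the integral formula on `L¹ ∩ L²`. -/
theorem fourier_toLp_ae_eq {f : Rd d → ℂ} (hf : Integrable f) (hf2 : MemLp f 2) :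
    (𝓕 (hf2.toLp f) : Lp ℂ 2 (volume : Measure (Rd d))) =ᵐ[volume] 𝓕 f := by
  have hcont : Continuous (𝓕 f) :=
    VectorFourier.fourierIntegral_continuous Real.continuous_fourierChar
      (by exact continuous_inner) hf
  -- Both transforms satisfy the multiplication formula `∫ G û = ∫ Ĝ u`, so they agree when tested
  -- against smooth compactly supported functions.
  refine ae_eq_of_integral_contDiff_smul_eq
    ((Lp.memLp _).locallyIntegrable (by norm_num)) hcont.locallyIntegrable
    fun g hg hgc => ?_
  let G : SchwartzMap (Rd d) ℂ := (hgc.comp_left Complex.ofReal_zero).toSchwartzMap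
    (Complex.ofRealCLM.contDiff.comp hg)
  have hG : ∀ x, G x = (g x : ℂ) := fun x => rfl
  have h1 := congrArg (fun T => T G)
    (Lp.fourier_toTemperedDistribution_eq (E := Rd d) (F := ℂ) (hf2.toLp f))
  rw [TemperedDistribution.fourier_apply] at h1
  rw [Lp.toTemperedDistribution_apply, Lp.toTemperedDistribution_apply] at h1
  have h2 : ∫ x, (𝓕 G) x • f x = ∫ x, G x • 𝓕 f x := by
    have := VectorFourier.integral_bilin_fourierIntegral_eq_flip (.lsmul ℂ ℂ) (L := innerₗ (Rd d))
      Real.continuous_fourierChar (by exact continuous_inner) (G.integrable (μ := volume)) hf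
    simpa using! this
  calc ∫ x, g x • (𝓕 (hf2.toLp f) : Lp ℂ 2 (volume : Measure (Rd d))) x
      = ∫ x, G x • (𝓕 (hf2.toLp f) : Lp ℂ 2 (volume : Measure (Rd d))) x := by
        congr 1
    _ = ∫ x, (𝓕 G) x • (hf2.toLp f) x := h1.symm
    _ = ∫ x, (𝓕 G) x • f x := by
        refine integral_congr_ae ?_
        filter_upwards [hf2.coeFn_toLp] with x hx
        rw [hx]
    _ = ∫ x, G x • 𝓕 f x := h2
    _ = _ := by congr 1

/-- Plancherel in the normalization `e^{-2πi x·w}`, rescaled by `ξ = 2πw`; the Jacobian is the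
factor `(2π)^d`. -/
theorem memLp_fourierFun {f : Rd d → ℂ} (hf : Integrable f) (hf2 : MemLp f 2) :
    Integrable (fun ξ => ‖fourierFun f ξ‖ ^ 2) ∧
      ∫ ξ, ‖fourierFun f ξ‖ ^ 2 = (2 * Real.pi) ^ d * ∫ x, ‖f x‖ ^ 2 := by
  have hpi : (2 * Real.pi) ≠ 0 := by positivity
  have hae := fourier_toLp_ae_eq hf hf2
  have hmem : MemLp (𝓕 f) 2 (volume : Measure (Rd d)) := (memLp_congr_ae hae).1 (Lp.memLp _)
  have hcomp : (fun w => ‖fourierFun f ((2 * Real.pi) • w)‖ ^ 2) = fun w => ‖𝓕 f w‖ ^ 2 := by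
    ext w; rw [fourierFun_smul_two_pi]
  have hnorm : ∫ w, ‖𝓕 f w‖ ^ 2 = ∫ x, ‖f x‖ ^ 2 := by
    have h1 : ∀ u : Lp ℂ 2 (volume : Measure (Rd d)), ‖u‖ ^ 2 = ∫ x, ‖u x‖ ^ 2 := fun u => by
      rw [← @inner_self_eq_norm_sq ℂ, L2.inner_def]
      simp only [inner_self_eq_norm_sq_to_K]
      rw [← integral_re]
      · congr 1; ext x; norm_cast
      · exact_mod_cast ((memLp_two_iff_integrable_sq_norm (Lp.memLp u).1).1 (Lp.memLp u)).ofReal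
    have h2 := h1 (𝓕 (hf2.toLp f))
    rw [Lp.norm_fourier_eq, h1] at h2
    have h3 := integral_congr_ae (hae.fun_comp fun z => ‖z‖ ^ 2)
    have h4 := integral_congr_ae (hf2.coeFn_toLp.fun_comp fun z => ‖z‖ ^ 2)
    exact h3.symm.trans (h2.symm.trans h4)
  refine ⟨?_, ?_⟩
  · rw [← integrable_comp_smul_iff volume _ hpi, hcomp]
    exact (memLp_two_iff_integrable_sq_norm hmem.1).1 hmem
  · have := Measure.integral_comp_smul (volume : Measure (Rd d))
      (fun ξ => ‖fourierFun f ξ‖ ^ 2) (2 * Real.pi)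
    rw [hcomp, hnorm] at this
    rw [this, finrank_euclideanSpace, Fintype.card_fin, smul_eq_mul, abs_of_pos (by positivity)]
    field_simp

end

/-! ### Exponential decay and summation over scales. -/

section

/-- The first bound wins when `m + n` is large and positive. Otherwise the smaller of `m`, `n` is
negative and controls the other in absolute value, up to a factor of two, so the second or third
bound wins. -/
theorem le_two_rpow_neg_abs {α a b B m n t : ℝ} (hα : 0 < α) (ha : α ≤ a) (hb : α ≤ b)
    (hB : 0 ≤ B) (h1 : t ≤ B * 2 ^ (-(b * (m + n) / 2))) (h2 : t ≤ B * 2 ^ (a * m / 2))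
    (h3 : t ≤ B * 2 ^ (a * n / 2)) :
    t ≤ B * (2 ^ (-(α / 8 * |m|)) * 2 ^ (-(α / 8 * |n|))) := by
  rw [← Real.rpow_add two_pos]
  have key : ∀ e : ℝ, t ≤ B * 2 ^ e → e ≤ -(α / 8 * |m|) + -(α / 8 * |n|) →
      t ≤ B * 2 ^ (-(α / 8 * |m|) + -(α / 8 * |n|)) := fun e h h' =>
    h.trans (mul_le_mul_of_nonneg_left (Real.rpow_le_rpow_of_exponent_le one_le_two h') hB)
  have neg : ∀ {x : ℝ}, x ≤ 0 → a * x ≤ α * x := fun h => mul_le_mul_of_nonpos_right ha h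
  have pos : ∀ {x : ℝ}, 0 ≤ x → α * x ≤ b * x := fun h => mul_le_mul_of_nonneg_right hb h
  have aux : ∀ {x y : ℝ}, x ≤ y → x ≤ 0 →
      a * x / 2 ≤ -(α / 8 * |x|) + -(α / 8 * |y|) ∨
      -(b * (x + y) / 2) ≤ -(α / 8 * |x|) + -(α / 8 * |y|) := by
    intro x y hxy hx
    rw [abs_of_nonpos hx]
    -- If `y ≤ -2x`, then `|x| + |y| ≤ 3|x|`; otherwise `|x| + |y| ≤ 3(x + y)`. Both cases cost a
    -- factor `3/8 ≤ 1/2`, whence the rate `α/8`.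
    rcases le_or_gt y (-(2 * x)) with hy | hy
    · left
      have : |y| ≤ -(2 * x) := abs_le.2 ⟨by linarith, hy⟩
      nlinarith [neg hx, mul_le_mul_of_nonneg_left this hα.le, mul_nonneg hα.le (neg_nonneg.2 hx)]
    · right
      rw [abs_of_nonneg (by linarith)]
      nlinarith [pos (show 0 ≤ x + y by linarith), mul_pos hα (show 0 < y + 2 * x by linarith),
        mul_nonneg hα.le (neg_nonneg.2 hx)]
  rcases le_total m n with hmn | hmn
  · rcases le_total m 0 with hm | hm
    · rcases aux hmn hm with h | h
      · exact key _ h2 h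
      · exact key _ h1 h
    · refine key _ h1 ?_
      rw [abs_of_nonneg hm, abs_of_nonneg (hm.trans hmn)]
      nlinarith [pos (show 0 ≤ m + n by linarith), mul_nonneg hα.le (show 0 ≤ m + n by linarith)]
  · rcases le_total n 0 with hm | hm
    · rcases aux hmn hm with h | h
      · exact key _ h3 (by linarith)
      · exact key _ h1 (by rw [add_comm m n]; linarith)
    · refine key _ h1 ?_
      rw [abs_of_nonneg hm, abs_of_nonneg (hm.trans hmn)]
      nlinarith [pos (show 0 ≤ m + n by linarith), mul_nonneg hα.le (show 0 ≤ m + n by linarith)]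

theorem summable_two_rpow_neg_abs {c : ℝ} (hc : 0 < c) :
    Summable (fun m : ℤ => (2 : ℝ) ^ (-(c * |(m : ℝ)|))) := by
  have h : Summable (fun n : ℕ => (2 : ℝ) ^ (-(c * (n : ℝ)))) := by
    have : (fun n : ℕ => (2 : ℝ) ^ (-(c * (n : ℝ)))) = fun n : ℕ => ((2 : ℝ) ^ (-c)) ^ n := by
      ext n; rw [← Real.rpow_mul_natCast two_pos.le]; ring_nf
    rw [this]
    exact summable_geometric_of_lt_one (by positivity)
      (Real.rpow_lt_one_of_one_lt_of_neg one_lt_two (by linarith))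
  refine Summable.of_nat_of_neg ?_ ?_ <;> simpa using h

/-- The constant `∑_m 2^{-α|m|/8}`. -/
noncomputable def decaySum (α : ℝ) : ℝ := ∑' m : ℤ, (2 : ℝ) ^ (-(α / 8 * |(m : ℝ)|))

theorem decaySum_pos {α : ℝ} (hα : 0 < α) : 0 < decaySum α :=
  (summable_two_rpow_neg_abs (by positivity)).tsum_pos (fun _ => by positivity) 0 (by positivity)

theorem sum_decay_le {α : ℝ} (hα : 0 < α) {ι : Type*} (s : Finset ι) (e : ι → ℤ)
    (he : Function.Injective e) :
    ∑ l ∈ s, (2 : ℝ) ^ (-(α / 8 * |((e l : ℤ) : ℝ)|)) ≤ decaySum α := by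
  have hs := summable_two_rpow_neg_abs (show 0 < α / 8 by positivity)
  have := hs.sum_le_tsum (s.map ⟨e, he⟩) (fun _ _ => by positivity)
  simpa [Finset.sum_map, decaySum] using this

/-- A trilinear Schur estimate with kernel `2^{-c|j+k|} 2^{-c|j+l|}`. -/
theorem sum_schur_le {α : ℝ} (hα : 0 < α) (J : Finset ℕ) (s : Finset ℤ) {X Y : ℤ → ℝ}
    (hX : ∀ k, 0 ≤ X k) (hY : ∀ k, 0 ≤ Y k) (hX1 : ∑ k ∈ s, X k ≤ 1) (hY1 : ∑ k ∈ s, Y k ≤ 1) :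
    ∑ j ∈ J, ∑ k ∈ s, ∑ l ∈ s, √(X k) * √(Y l) *
      ((2 : ℝ) ^ (-(α / 8 * |((j : ℝ) + k)|)) * (2 : ℝ) ^ (-(α / 8 * |((j : ℝ) + l)|)))
      ≤ decaySum α ^ 2 := by
  set w : ℕ → ℤ → ℝ := fun j k => (2 : ℝ) ^ (-(α / 8 * |((j : ℝ) + k)|)) with hw
  have hw0 : ∀ j k, 0 ≤ w j k := fun j k => by positivity
  have hS := (decaySum_pos hα).le
  have hwk : ∀ k, ∑ j ∈ J, w j k ≤ decaySum α := fun k => by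
    simpa [hw] using sum_decay_le hα J (fun j : ℕ => (j : ℤ) + k)
      (fun i j h => by simpa using h)
  have hwj : ∀ j, ∑ k ∈ s, w j k ≤ decaySum α := fun j => by
    simpa [hw] using sum_decay_le hα s (fun k : ℤ => (j : ℤ) + k) (add_right_injective _)
  -- With a weight in one index only, the other level index sums freely, then `j` does, each costing
  -- one `decaySum α`.
  have one : ∀ Z : ℤ → ℝ, (∀ k, 0 ≤ Z k) → ∑ k ∈ s, Z k ≤ 1 →
      ∑ j ∈ J, ∑ k ∈ s, ∑ l ∈ s, Z k * (w j k * w j l) ≤ decaySum α ^ 2 := by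
    intro Z hZ hZ1
    calc ∑ j ∈ J, ∑ k ∈ s, ∑ l ∈ s, Z k * (w j k * w j l)
        ≤ ∑ j ∈ J, ∑ k ∈ s, Z k * (w j k * decaySum α) := by
          refine Finset.sum_le_sum fun j _ => Finset.sum_le_sum fun k _ => ?_
          rw [← Finset.mul_sum, ← Finset.mul_sum]
          exact mul_le_mul_of_nonneg_left (mul_le_mul_of_nonneg_left (hwj j) (hw0 j k)) (hZ k)
      _ = ∑ k ∈ s, Z k * ((∑ j ∈ J, w j k) * decaySum α) := by
          rw [Finset.sum_comm]
          refine Finset.sum_congr rfl fun k _ => ?_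
          rw [Finset.sum_mul, Finset.mul_sum]
      _ ≤ ∑ k ∈ s, Z k * decaySum α ^ 2 := by
          refine Finset.sum_le_sum fun k _ => mul_le_mul_of_nonneg_left ?_ (hZ k)
          rw [sq]
          exact mul_le_mul_of_nonneg_right (hwk k) hS
      _ ≤ decaySum α ^ 2 := by
          rw [← Finset.sum_mul]
          exact mul_le_of_le_one_left (by positivity) hZ1
  have hXs := one X hX hX1
  have hYs := one Y hY hY1
  have hYs' : ∑ j ∈ J, ∑ k ∈ s, ∑ l ∈ s, Y l * (w j k * w j l) ≤ decaySum α ^ 2 := by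
    refine le_trans (le_of_eq (Finset.sum_congr rfl fun j _ => ?_)) hYs
    rw [Finset.sum_comm]
    refine Finset.sum_congr rfl fun k _ => Finset.sum_congr rfl fun l _ => by ring
  calc _ ≤ ∑ j ∈ J, ∑ k ∈ s, ∑ l ∈ s,
        ((1 / 2) * (X k * (w j k * w j l)) + (1 / 2) * (Y l * (w j k * w j l))) := by
        refine Finset.sum_le_sum fun j _ => Finset.sum_le_sum fun k _ =>
          Finset.sum_le_sum fun l _ => ?_
        -- The arithmetic-geometric mean inequality decouples the two weights.
        have h1 : √(X k) * √(Y l) ≤ (X k + Y l) / 2 := by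
          nlinarith [Real.sq_sqrt (hX k), Real.sq_sqrt (hY l), sq_nonneg (√(X k) - √(Y l))]
        have h2 : 0 ≤ w j k * w j l := mul_nonneg (hw0 _ _) (hw0 _ _)
        have := mul_le_mul_of_nonneg_right h1 h2
        simp only [hw] at this ⊢
        linarith
    _ ≤ _ := by
        have h : ∀ a b : ℕ → ℤ → ℤ → ℝ, ∑ j ∈ J, ∑ k ∈ s, ∑ l ∈ s,
            ((1 / 2) * a j k l + (1 / 2) * b j k l) = (1 / 2) * (∑ j ∈ J, ∑ k ∈ s, ∑ l ∈ s, a j k l)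
            + (1 / 2) * ∑ j ∈ J, ∑ k ∈ s, ∑ l ∈ s, b j k l := fun a b => by
          simp only [Finset.sum_add_distrib, Finset.mul_sum]
        rw [h fun j k l => X k * (w j k * w j l)]
        linarith

/-! ### Test functions. -/

variable {d : ℕ}

/-- Measurable functions that vanish off `E` and are bounded above and below where nonzero. -/
structure IsTest (E : Set (Rd d)) (f : Rd d → ℂ) : Prop where
  meas : Measurable f
  supp : ∀ x, x ∉ E → f x = 0
  bdd : ∃ n : ℕ, ∀ x, f x = 0 ∨ (((n : ℝ) + 1)⁻¹ ≤ ‖f x‖ ∧ ‖f x‖ ≤ (n : ℝ) + 1)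

theorem IsTest.norm_bdd {E : Set (Rd d)} {f : Rd d → ℂ} (hf : IsTest E f) :
    ∃ L : ℝ, 0 < L ∧ ∀ x, ‖f x‖ ≤ L := by
  obtain ⟨n, hn⟩ := hf.bdd
  refine ⟨n + 1, by positivity, fun x => ?_⟩
  rcases hn x with h | h
  · rw [h, norm_zero]; positivity
  · exact h.2

theorem IsTest.integrable_rpow {E : Set (Rd d)} {f : Rd d → ℂ} (hf : IsTest E f)
    (hE : MeasurableSet E) (hE' : volume E ≠ ⊤) {r : ℝ} (hr : 0 < r) :
    Integrable (fun x => ‖f x‖ ^ r) := by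
  obtain ⟨L, hL, h⟩ := hf.norm_bdd
  refine Integrable.mono' ((integrable_indicator_iff hE).2 (integrableOn_const (C := L ^ r) hE'))
    (hf.meas.norm.pow_const r).aestronglyMeasurable (Eventually.of_forall fun x => ?_)
  by_cases hx : x ∈ E
  · rw [Set.indicator_of_mem hx, Real.norm_of_nonneg (by positivity)]
    exact Real.rpow_le_rpow (norm_nonneg _) (h x) hr.le
  · rw [Set.indicator_of_notMem hx, hf.supp x hx, norm_zero, Real.zero_rpow hr.ne', norm_zero]

theorem IsTest.integrable {E : Set (Rd d)} {f : Rd d → ℂ} (hf : IsTest E f)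
    (hE : MeasurableSet E) (hE' : volume E ≠ ⊤) : Integrable f := by
  have := hf.integrable_rpow hE hE' one_pos
  simp only [Real.rpow_one] at this
  exact (integrable_norm_iff hf.meas.aestronglyMeasurable).1 this

theorem IsTest.integrable_sq {E : Set (Rd d)} {f : Rd d → ℂ} (hf : IsTest E f)
    (hE : MeasurableSet E) (hE' : volume E ≠ ⊤) : Integrable (fun x => ‖f x‖ ^ 2) := by
  simpa using hf.integrable_rpow hE hE' two_pos

theorem IsTest.restrict {E : Set (Rd d)} {f g : Rd d → ℂ} (hf : IsTest E f) (hg : Measurable g)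
    (h : ∀ x, g x = 0 ∨ g x = f x) : IsTest E g := by
  refine ⟨hg, fun x hx => ?_, ?_⟩
  · rcases h x with h | h
    · exact h
    · rw [h, hf.supp x hx]
  · obtain ⟨n, hn⟩ := hf.bdd
    refine ⟨n, fun x => ?_⟩
    rcases h x with h | h
    · exact Or.inl h
    · rw [h]; exact hn x

theorem IsTest.of_norm_eq {E : Set (Rd d)} {f g : Rd d → ℂ} (hf : IsTest E f) (hg : Measurable g)
    (h : ∀ x, ‖g x‖ = ‖f x‖) : IsTest E g := by
  refine ⟨hg, fun x hx => ?_, ?_⟩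
  · rw [← norm_eq_zero, h, hf.supp x hx, norm_zero]
  · obtain ⟨n, hn⟩ := hf.bdd
    refine ⟨n, fun x => ?_⟩
    rw [← norm_eq_zero, h, norm_eq_zero]; exact hn x

theorem IsTest.const_mul {E : Set (Rd d)} {f : Rd d → ℂ} (hf : IsTest E f) {c : ℝ} (hc : 0 < c) :
    IsTest E (fun x => (c : ℂ) * f x) := by
  refine ⟨hf.meas.const_mul _, fun x hx => by rw [hf.supp x hx, mul_zero], ?_⟩
  obtain ⟨n, hn⟩ := hf.bdd
  obtain ⟨m, hm⟩ := exists_nat_ge (max c c⁻¹ * (n + 1))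
  have h1 : c * (n + 1) ≤ m + 1 :=
    (mul_le_mul_of_nonneg_right (le_max_left _ _) (by positivity)).trans (hm.trans (by linarith))
  have h2 : c⁻¹ * (n + 1) ≤ m + 1 :=
    (mul_le_mul_of_nonneg_right (le_max_right _ _) (by positivity)).trans (hm.trans (by linarith))
  refine ⟨m, fun x => ?_⟩
  rcases hn x with h | ⟨h, h'⟩
  · left; rw [h, mul_zero]
  · right
    rw [norm_mul, Complex.norm_real, Real.norm_of_nonneg hc.le]
    refine ⟨?_, (mul_le_mul_of_nonneg_left h' hc.le).trans h1⟩
    refine le_trans ?_ (mul_le_mul_of_nonneg_left h hc.le)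
    rw [inv_le_comm₀ (by positivity) (by positivity), mul_inv, inv_inv]
    exact h2

end

/-! ### Level-set decomposition and the three-bound interpolation. -/

section
variable {d : ℕ}

/-- The part of `f` where `2^{σk} ≤ |f| < 2^{σ(k+1)}`. -/
noncomputable def levelPart (σ : ℝ) (f : Rd d → ℂ) (k : ℤ) (x : Rd d) : ℂ :=
  if ⌊Real.logb 2 ‖f x‖ / σ⌋ = k then f x else 0

theorem levelPart_eq (σ : ℝ) (f : Rd d → ℂ) (k : ℤ) (x : Rd d) :
    levelPart σ f k x = 0 ∨ levelPart σ f k x = f x := by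
  unfold levelPart; split_ifs <;> simp

theorem IsTest.levelPart {E : Set (Rd d)} {f : Rd d → ℂ} (hf : IsTest E f) (σ : ℝ) (k : ℤ) :
    IsTest E (levelPart σ f k) := by
  refine hf.restrict (Measurable.ite ?_ hf.meas measurable_const) (levelPart_eq σ f k)
  have h : Measurable fun x => ⌊Real.logb 2 ‖f x‖ / σ⌋ := by
    refine Int.measurable_floor.comp ?_
    exact ((Real.measurable_log.comp hf.meas.norm).div_const _).div_const _
  exact h (measurableSet_singleton k)

theorem IsTest.exists_levels {E : Set (Rd d)} {f : Rd d → ℂ} (hf : IsTest E f) {σ : ℝ}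
    (hσ : 0 < σ) : ∃ s : Finset ℤ, ∀ x, f x ≠ 0 → ⌊Real.logb 2 ‖f x‖ / σ⌋ ∈ s := by
  obtain ⟨n, hn⟩ := hf.bdd
  refine ⟨Finset.Icc ⌊Real.logb 2 ((n : ℝ) + 1)⁻¹ / σ⌋ ⌊Real.logb 2 ((n : ℝ) + 1) / σ⌋,
    fun x hx => ?_⟩
  obtain ⟨h1, h2⟩ := (hn x).resolve_left hx
  rw [Finset.mem_Icc]
  constructor
  · refine Int.floor_le_floor (div_le_div_of_nonneg_right ?_ hσ.le)
    exact Real.logb_le_logb_of_le one_lt_two (by positivity) h1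
  · refine Int.floor_le_floor (div_le_div_of_nonneg_right ?_ hσ.le)
    exact Real.logb_le_logb_of_le one_lt_two (norm_pos_iff.2 hx) h2

theorem sum_levelPart {σ : ℝ} {f : Rd d → ℂ} {s : Finset ℤ}
    (hs : ∀ x, f x ≠ 0 → ⌊Real.logb 2 ‖f x‖ / σ⌋ ∈ s) (x : Rd d) :
    ∑ k ∈ s, levelPart σ f k x = f x := by
  by_cases hx : f x = 0
  · rw [hx]; refine Finset.sum_eq_zero fun k _ => ?_
    rcases levelPart_eq σ f k x with h | h <;> rw [h]; exact hx
  · simp only [levelPart]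
    rw [Finset.sum_ite_eq, if_pos (hs x hx)]

theorem sum_norm_levelPart_rpow {σ p : ℝ} (hp : 0 < p) {f : Rd d → ℂ} {s : Finset ℤ}
    (hs : ∀ x, f x ≠ 0 → ⌊Real.logb 2 ‖f x‖ / σ⌋ ∈ s) (x : Rd d) :
    ∑ k ∈ s, ‖levelPart σ f k x‖ ^ p = ‖f x‖ ^ p := by
  by_cases hx : f x = 0
  · rw [hx, norm_zero, Real.zero_rpow hp.ne']; refine Finset.sum_eq_zero fun k _ => ?_
    have : levelPart σ f k x = 0 := by
      rcases levelPart_eq σ f k x with h | h <;> rw [h]; exact hx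
    rw [this, norm_zero, Real.zero_rpow hp.ne']
  · have : ∀ k, ‖levelPart σ f k x‖ ^ p =
        if ⌊Real.logb 2 ‖f x‖ / σ⌋ = k then ‖f x‖ ^ p else 0 := fun k => by
      rw [levelPart]; split_ifs <;> simp [hp.ne']
    simp only [this]
    rw [Finset.sum_ite_eq, if_pos (hs x hx)]

theorem levelPart_bounds {σ : ℝ} (hσ : 0 < σ) {f : Rd d → ℂ} {k : ℤ} {x : Rd d}
    (hx : levelPart σ f k x ≠ 0) :
    (2 : ℝ) ^ (σ * k) ≤ ‖levelPart σ f k x‖ ∧ ‖levelPart σ f k x‖ ≤ 2 ^ (σ * (k + 1)) := by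
  unfold levelPart at hx ⊢
  split_ifs at hx ⊢ with h
  · have hpos : 0 < ‖f x‖ := norm_pos_iff.2 hx
    obtain ⟨h1, h2⟩ := Int.floor_eq_iff.1 h
    rw [le_div_iff₀ hσ] at h1
    rw [div_lt_iff₀ hσ] at h2
    constructor
    · rw [← Real.le_logb_iff_rpow_le one_lt_two hpos]; linarith
    · rw [← Real.logb_le_iff_le_rpow one_lt_two hpos]; linarith
  · exact absurd rfl hx

/-- On its level `|f|^{p-1} ≥ 2^{σk(p-1)} = 2^{kb/2}`. The companion bound for the square uses the
upper end of the level, hence its `k + 1`. -/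
theorem norm_levelPart_le {σ p b : ℝ} (hσ : 0 < σ) (hp : 1 ≤ p) (hb : σ * (p - 1) = b / 2)
    (f : Rd d → ℂ) (k : ℤ) (x : Rd d) :
    ‖levelPart σ f k x‖ ≤ 2 ^ (-(k * b / 2)) * ‖levelPart σ f k x‖ ^ p := by
  by_cases hx : levelPart σ f k x = 0
  · rw [hx, norm_zero]; positivity
  obtain ⟨h1, -⟩ := levelPart_bounds hσ hx
  set t := ‖levelPart σ f k x‖
  have ht : 0 < t := norm_pos_iff.2 hx
  have h2 : t ^ p = t * t ^ (p - 1) := by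
    rw [← Real.rpow_one_add' ht.le (by linarith)]; congr 1; ring
  have h3 : (2 : ℝ) ^ (k * b / 2) ≤ t ^ (p - 1) := by
    have := Real.rpow_le_rpow (by positivity) h1 (sub_nonneg.2 hp)
    rw [← Real.rpow_mul two_pos.le] at this
    convert this using 2
    rw [mul_right_comm, hb]; ring
  rw [h2, Real.rpow_neg two_pos.le, ← div_eq_inv_mul, le_div_iff₀ (by positivity)]
  exact mul_le_mul_of_nonneg_left h3 ht.le

theorem norm_levelPart_sq_le {σ p a : ℝ} (hσ : 0 < σ) (hp : p ≤ 2) (ha : σ * (2 - p) = a)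
    (f : Rd d → ℂ) (k : ℤ) (x : Rd d) :
    ‖levelPart σ f k x‖ ^ 2 ≤ 2 ^ ((k + 1) * a) * ‖levelPart σ f k x‖ ^ p := by
  by_cases hx : levelPart σ f k x = 0
  · rw [hx, norm_zero, zero_pow two_ne_zero]; positivity
  obtain ⟨-, h1⟩ := levelPart_bounds hσ hx
  set t := ‖levelPart σ f k x‖
  have ht : 0 < t := norm_pos_iff.2 hx
  have h2 : t ^ 2 = t ^ (2 - p) * t ^ p := by
    rw [← Real.rpow_add ht, ← Real.rpow_natCast]; congr 1; push_cast; ring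
  have h3 : t ^ (2 - p) ≤ (2 : ℝ) ^ ((k + 1) * a) := by
    have := Real.rpow_le_rpow ht.le h1 (sub_nonneg.2 hp)
    rw [← Real.rpow_mul two_pos.le] at this
    convert this using 2
    rw [mul_right_comm, ha]; ring
  rw [h2]
  exact mul_le_mul_of_nonneg_right h3 (by positivity)

/-- The two relations for `σ` give `‖f_l‖₁ ≤ 2^{-lb/2} X_l` and `‖f_l‖₂ ≤ 2^{(l+1)a/2} √X_l`, where
`X_l = ‖f_l‖_p^p`. Hence `H1`, `H2`, `H3` become the three bounds of `le_two_rpow_neg_abs` at `(j +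
l, j + l')`. The extra `2^{a/2}` from `l + 1` is absorbed in `2^{β/2}`. -/
theorem sum_norm_form_le_of_normalized {p a b A B α β σ : ℝ} (hα : 0 < α) (ha : α ≤ a)
    (hb : α ≤ b) (haβ : a ≤ β) (hp1 : 1 ≤ p) (hp2 : p ≤ 2) (hσ : 0 < σ)
    (hσb : σ * (p - 1) = b / 2) (hσa : σ * (2 - p) = a) (hA : 0 ≤ A) (hAB : A ≤ B)
    {E : Set (Rd d)} (hE : MeasurableSet E) (hE' : volume E ≠ ⊤)
    {k : ℕ → Rd d → ℂ} (hk : ∀ j, Continuous (k j)) {c : ℕ → ℝ} (hc : ∀ j x, ‖k j x‖ ≤ c j)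
    (H1 : ∀ j F G, IsTest E F → IsTest E G →
      ‖form (k j) F G‖ ≤ A * 2 ^ (-(j * b)) * (∫ x, ‖F x‖) * ∫ x, ‖G x‖)
    (H2 : ∀ j F G, IsTest E F → IsTest E G →
      ‖form (k j) F G‖ ≤ B * 2 ^ (j * a / 2) * √(∫ x, ‖F x‖ ^ 2) * (∫ x, ‖G x‖ ^ p) ^ (1 / p))
    (H3 : ∀ j F G, IsTest E F → IsTest E G →
      ‖form (k j) F G‖ ≤ B * 2 ^ (j * a / 2) * (∫ x, ‖F x‖ ^ p) ^ (1 / p) * √(∫ x, ‖G x‖ ^ 2))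
    {f g : Rd d → ℂ} (hf : IsTest E f) (hg : IsTest E g) (hf1 : ∫ x, ‖f x‖ ^ p ≤ 1)
    (hg1 : ∫ x, ‖g x‖ ^ p ≤ 1) (J : Finset ℕ) :
    ∑ j ∈ J, ‖form (k j) f g‖ ≤ B * 2 ^ (β / 2) * decaySum α ^ 2 := by
  have hp0 : 0 < p := by linarith
  have hB : 0 ≤ B := hA.trans hAB
  obtain ⟨s₁, hs₁⟩ := hf.exists_levels hσ
  obtain ⟨s₂, hs₂⟩ := hg.exists_levels hσ
  set s := s₁ ∪ s₂
  replace hs₁ : ∀ x, f x ≠ 0 → ⌊Real.logb 2 ‖f x‖ / σ⌋ ∈ s := fun x hx =>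
    Finset.mem_union_left _ (hs₁ x hx)
  replace hs₂ : ∀ x, g x ≠ 0 → ⌊Real.logb 2 ‖g x‖ / σ⌋ ∈ s := fun x hx =>
    Finset.mem_union_right _ (hs₂ x hx)
  set X : (Rd d → ℂ) → ℤ → ℝ := fun u l => ∫ x, ‖levelPart σ u l x‖ ^ p with hX
  have hX0 : ∀ u l, 0 ≤ X u l := fun u l => integral_nonneg fun x => by positivity
  have hXs : ∀ u, IsTest E u → (∀ x, u x ≠ 0 → ⌊Real.logb 2 ‖u x‖ / σ⌋ ∈ s) →
      ∫ x, ‖u x‖ ^ p ≤ 1 → ∑ l ∈ s, X u l ≤ 1 := by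
    intro u hu hus hu1
    rw [← integral_finsetSum _ fun l _ => (hu.levelPart σ l).integrable_rpow hE hE' hp0]
    simpa only [sum_norm_levelPart_rpow hp0 hus] using hu1
  have hXf := hXs f hf hs₁ hf1
  have hXg := hXs g hg hs₂ hg1
  have hN1 : ∀ u, IsTest E u → ∀ l : ℤ,
      ∫ x, ‖levelPart σ u l x‖ ≤ 2 ^ (-(l * b / 2)) * X u l := by
    intro u hu l
    rw [hX, ← integral_const_mul]
    exact integral_mono ((hu.levelPart σ l).integrable hE hE').norm
      (((hu.levelPart σ l).integrable_rpow hE hE' hp0).const_mul _)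
      (norm_levelPart_le hσ hp1 hσb u l)
  have hN2 : ∀ u, IsTest E u → ∀ l : ℤ,
      √(∫ x, ‖levelPart σ u l x‖ ^ 2) ≤ 2 ^ ((l + 1) * a / 2) * √(X u l) := by
    intro u hu l
    have h1 : ∫ x, ‖levelPart σ u l x‖ ^ 2 ≤ 2 ^ ((l + 1) * a) * X u l := by
      rw [hX, ← integral_const_mul]
      exact integral_mono ((hu.levelPart σ l).integrable_sq hE hE')
        (((hu.levelPart σ l).integrable_rpow hE hE' hp0).const_mul _)
        (norm_levelPart_sq_le hσ hp2 hσa u l)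
    refine (Real.sqrt_le_sqrt h1).trans (le_of_eq ?_)
    rw [Real.sqrt_mul (by positivity), Real.sqrt_eq_rpow, ← Real.rpow_mul two_pos.le]
    congr 2; ring
  -- Normalization gives `X ≤ 1`, and `p ≤ 2`, so every power of `X` that occurs can be weakened to
  -- the common `√X` expected by the Schur estimate.
  have hroot : ∀ {t : ℝ}, 0 ≤ t → t ≤ 1 → t ≤ √t ∧ t ^ (1 / p) ≤ √t := by
    intro t h0 h1
    constructor
    · rw [Real.sqrt_eq_rpow]
      simpa using Real.rpow_le_rpow_of_exponent_ge' h0 h1 (by norm_num : (0 : ℝ) ≤ 1 / 2)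
        (by norm_num : (1 / 2 : ℝ) ≤ 1)
    · rw [Real.sqrt_eq_rpow]
      exact Real.rpow_le_rpow_of_exponent_ge' h0 h1 (by norm_num)
        (one_div_le_one_div_of_le hp0 hp2)
  have hX1 : ∀ u, ∑ l ∈ s, X u l ≤ 1 → ∀ l ∈ s, X u l ≤ 1 := fun u hu l hl =>
    (Finset.single_le_sum (fun i _ => hX0 u i) hl).trans hu
  have hβ1 : (1 : ℝ) ≤ 2 ^ (β / 2) := Real.one_le_rpow one_le_two (by linarith)
  have haβ' : (2 : ℝ) ^ (a / 2) ≤ 2 ^ (β / 2) :=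
    Real.rpow_le_rpow_of_exponent_le one_le_two (by linarith)
  have hterm : ∀ j : ℕ, ∀ l ∈ s, ∀ l' ∈ s, ‖form (k j) (levelPart σ f l) (levelPart σ g l')‖ ≤
      (B * 2 ^ (β / 2)) * (√(X f l) * √(X g l') * ((2 : ℝ) ^ (-(α / 8 * |((j : ℝ) + l)|)) *
        (2 : ℝ) ^ (-(α / 8 * |((j : ℝ) + l')|)))) := by
    intro j l hl l' hl'
    have hFl := hf.levelPart σ l
    have hGl := hg.levelPart σ l'
    obtain ⟨rf1, rf2⟩ := hroot (hX0 f l) (hX1 f hXf l hl)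
    obtain ⟨rg1, rg2⟩ := hroot (hX0 g l') (hX1 g hXg l' hl')
    rw [← mul_assoc]
    refine le_two_rpow_neg_abs hα ha hb (by positivity) ?_ ?_ ?_
    · calc _ ≤ A * 2 ^ (-(j * b)) * (∫ x, ‖levelPart σ f l x‖) * ∫ x, ‖levelPart σ g l' x‖ :=
            H1 j _ _ hFl hGl
        _ ≤ (B * 2 ^ (β / 2)) * 2 ^ (-(j * b)) * (2 ^ (-(l * b / 2)) * √(X f l)) *
            (2 ^ (-(l' * b / 2)) * √(X g l')) := by
            gcongr
            · exact hAB.trans (le_mul_of_one_le_right hB hβ1)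
            · exact (hN1 f hf l).trans (by gcongr)
            · exact (hN1 g hg l').trans (by gcongr)
        _ = _ := by
            rw [show -(b * ((j : ℝ) + l + (j + l')) / 2)
              = -(j * b) + -(l * b / 2) + -(l' * b / 2) by ring, Real.rpow_add two_pos,
              Real.rpow_add two_pos]
            ring
    · calc _ ≤ _ := H2 j _ _ hFl hGl
        _ ≤ B * 2 ^ (j * a / 2) * (2 ^ ((l + 1) * a / 2) * √(X f l)) * √(X g l') := by
            gcongr
            · exact hN2 f hf l
        _ = B * 2 ^ (a / 2) * (√(X f l) * √(X g l')) * 2 ^ (a * (j + l) / 2) := by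
            rw [show ((l : ℝ) + 1) * a / 2 = l * a / 2 + a / 2 by ring,
              show a * ((j : ℝ) + l) / 2 = j * a / 2 + l * a / 2 by ring, Real.rpow_add two_pos,
              Real.rpow_add two_pos]
            ring
        _ ≤ _ := by gcongr
    · calc _ ≤ _ := H3 j _ _ hFl hGl
        _ ≤ B * 2 ^ (j * a / 2) * √(X f l) * (2 ^ ((l' + 1) * a / 2) * √(X g l')) := by
            gcongr
            · exact hN2 g hg l'
        _ = B * 2 ^ (a / 2) * (√(X f l) * √(X g l')) * 2 ^ (a * (j + l') / 2) := by
            rw [show ((l' : ℝ) + 1) * a / 2 = l' * a / 2 + a / 2 by ring,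
              show a * ((j : ℝ) + l') / 2 = j * a / 2 + l' * a / 2 by ring, Real.rpow_add two_pos,
              Real.rpow_add two_pos]
            ring
        _ ≤ _ := by gcongr
  have hexp : ∀ j, form (k j) f g =
      ∑ l ∈ s, ∑ l' ∈ s, form (k j) (levelPart σ f l) (levelPart σ g l') := by
    intro j
    have e1 : f = fun x => ∑ l ∈ s, levelPart σ f l x := funext fun x => (sum_levelPart hs₁ x).symm
    have e2 : g = fun x => ∑ l ∈ s, levelPart σ g l x := funext fun x => (sum_levelPart hs₂ x).symm
    conv_lhs => rw [e1]
    rw [form_sum_left s (hk j) (hc j) (fun l _ => (hf.levelPart σ l).integrable hE hE')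
      (hg.integrable hE hE')]
    refine Finset.sum_congr rfl fun l _ => ?_
    conv_lhs => rw [e2]
    exact form_sum_right s (hk j) (hc j) ((hf.levelPart σ l).integrable hE hE')
      (fun l _ => (hg.levelPart σ l).integrable hE hE')
  calc ∑ j ∈ J, ‖form (k j) f g‖
      ≤ ∑ j ∈ J, ∑ l ∈ s, ∑ l' ∈ s, ‖form (k j) (levelPart σ f l) (levelPart σ g l')‖ := by
        refine Finset.sum_le_sum fun j _ => ?_
        rw [hexp]
        exact (norm_sum_le _ _).trans (Finset.sum_le_sum fun l _ => norm_sum_le _ _)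
    _ ≤ ∑ j ∈ J, ∑ l ∈ s, ∑ l' ∈ s, (B * 2 ^ (β / 2)) * (√(X f l) * √(X g l') *
        ((2 : ℝ) ^ (-(α / 8 * |((j : ℝ) + l)|)) * (2 : ℝ) ^ (-(α / 8 * |((j : ℝ) + l')|)))) :=
        Finset.sum_le_sum fun j _ => Finset.sum_le_sum fun l hl =>
          Finset.sum_le_sum fun l' hl' => hterm j l hl l' hl'
    _ ≤ B * 2 ^ (β / 2) * decaySum α ^ 2 := by
        simp only [← Finset.mul_sum]
        refine mul_le_mul_of_nonneg_left ?_ (by positivity)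
        have := sum_schur_le hα J s (hX0 f) (hX0 g) hXf hXg
        simpa only [← Finset.mul_sum] using this

end

/-! ### Bounds for the dyadic pieces of `μ`. -/

section
variable {d : ℕ}

/-- The `L^p` norm, as a Bochner integral. -/
noncomputable def pnorm (p : ℝ) (f : Rd d → ℂ) : ℝ := (∫ x, ‖f x‖ ^ p) ^ (1 / p)

theorem pnorm_nonneg (p : ℝ) (f : Rd d → ℂ) : 0 ≤ pnorm p f :=
  Real.rpow_nonneg (integral_nonneg fun x => by positivity) _

theorem pnorm_rpow {p : ℝ} (hp : 0 < p) (f : Rd d → ℂ) : pnorm p f ^ p = ∫ x, ‖f x‖ ^ p := by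
  rw [pnorm, ← Real.rpow_mul (integral_nonneg fun x => by positivity), one_div,
    inv_mul_cancel₀ hp.ne', Real.rpow_one]

theorem integral_norm_rpow_normalize {p : ℝ} (hp : 0 < p) {f : Rd d → ℂ} (hf : 0 < pnorm p f) :
    ∫ x, ‖(((pnorm p f)⁻¹ : ℝ) : ℂ) * f x‖ ^ p = 1 := by
  have : ∀ x, ‖(((pnorm p f)⁻¹ : ℝ) : ℂ) * f x‖ ^ p = ((pnorm p f) ^ p)⁻¹ * ‖f x‖ ^ p := by
    intro x
    rw [norm_mul, Complex.norm_real, Real.norm_of_nonneg (inv_nonneg.2 hf.le),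
      Real.mul_rpow (inv_nonneg.2 hf.le) (norm_nonneg _), Real.inv_rpow hf.le]
  simp only [this]
  rw [integral_const_mul, ← pnorm_rpow hp]
  exact inv_mul_cancel₀ (Real.rpow_pos_of_pos hf p).ne'

/-- Homogeneity reduces to norm one; if a norm vanishes, `H3` or `H2` already makes every term zero.
-/
theorem sum_norm_form_le {p a b A B α β σ : ℝ} (hα : 0 < α) (ha : α ≤ a)
    (hb : α ≤ b) (haβ : a ≤ β) (hp1 : 1 ≤ p) (hp2 : p ≤ 2) (hσ : 0 < σ)
    (hσb : σ * (p - 1) = b / 2) (hσa : σ * (2 - p) = a) (hA : 0 ≤ A) (hAB : A ≤ B)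
    {E : Set (Rd d)} (hE : MeasurableSet E) (hE' : volume E ≠ ⊤)
    {k : ℕ → Rd d → ℂ} (hk : ∀ j, Continuous (k j)) {c : ℕ → ℝ} (hc : ∀ j x, ‖k j x‖ ≤ c j)
    (H1 : ∀ j F G, IsTest E F → IsTest E G →
      ‖form (k j) F G‖ ≤ A * 2 ^ (-(j * b)) * (∫ x, ‖F x‖) * ∫ x, ‖G x‖)
    (H2 : ∀ j F G, IsTest E F → IsTest E G →
      ‖form (k j) F G‖ ≤ B * 2 ^ (j * a / 2) * √(∫ x, ‖F x‖ ^ 2) * pnorm p G)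
    (H3 : ∀ j F G, IsTest E F → IsTest E G →
      ‖form (k j) F G‖ ≤ B * 2 ^ (j * a / 2) * pnorm p F * √(∫ x, ‖G x‖ ^ 2))
    {f g : Rd d → ℂ} (hf : IsTest E f) (hg : IsTest E g) (J : Finset ℕ) :
    ∑ j ∈ J, ‖form (k j) f g‖ ≤ B * 2 ^ (β / 2) * decaySum α ^ 2 * pnorm p f * pnorm p g := by
  have hp0 : 0 < p := by linarith
  rcases (pnorm_nonneg p f).eq_or_lt' with h0 | hf0
  · rw [h0, mul_zero, zero_mul]
    refine Finset.sum_nonpos fun j _ => ?_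
    simpa [h0] using H3 j f g hf hg
  rcases (pnorm_nonneg p g).eq_or_lt' with h0 | hg0
  · rw [h0, mul_zero]
    refine Finset.sum_nonpos fun j _ => ?_
    simpa [h0] using H2 j f g hf hg
  have := sum_norm_form_le_of_normalized hα ha hb haβ hp1 hp2 hσ hσb hσa hA hAB hE hE' hk hc
    H1 H2 H3 (hf.const_mul (inv_pos.2 hf0)) (hg.const_mul (inv_pos.2 hg0))
    (integral_norm_rpow_normalize hp0 hf0).le (integral_norm_rpow_normalize hp0 hg0).le J
  simp only [form_smul, norm_mul, Complex.norm_real, ← Finset.mul_sum,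
    Real.norm_of_nonneg (inv_nonneg.2 hf0.le), Real.norm_of_nonneg (inv_nonneg.2 hg0.le)] at this
  rw [← mul_inv, inv_mul_le_iff₀ (by positivity)] at this
  linarith

theorem integral_mul_le_sqrt_mul_sqrt {X : Type*} [MeasurableSpace X] {ρ : Measure X}
    {u v : X → ℝ} (hu0 : ∀ x, 0 ≤ u x) (hv0 : ∀ x, 0 ≤ v x) (hu : AEStronglyMeasurable u ρ)
    (hv : AEStronglyMeasurable v ρ) (hu2 : Integrable (fun x => u x ^ 2) ρ)
    (hv2 : Integrable (fun x => v x ^ 2) ρ) :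
    ∫ x, u x * v x ∂ρ ≤ √(∫ x, u x ^ 2 ∂ρ) * √(∫ x, v x ^ 2 ∂ρ) := by
  have h := integral_mul_le_Lp_mul_Lq_of_nonneg (μ := ρ) (f := u) (g := v)
    Real.HolderConjugate.two_two (Eventually.of_forall hu0)
    (Eventually.of_forall hv0) (by simpa using (memLp_two_iff_integrable_sq hu).2 hu2)
    (by simpa using (memLp_two_iff_integrable_sq hv).2 hv2)
  simpa [Real.sqrt_eq_rpow] using h

theorem integrable_convDensity_prod (μ : Measure (Rd d)) [IsFiniteMeasure μ] {φ : Rd d → ℂ}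
    (hφ : Integrable φ) :
    Integrable (fun p : Rd d × Rd d => φ (p.1 - p.2)) ((volume : Measure (Rd d)).prod μ) := by
  have := Integrable.convolution_integrand (ContinuousLinearMap.mul ℝ ℂ)
    (integrable_const (μ := μ) (1 : ℂ)) hφ
  simpa using this

theorem integrable_convDensity (μ : Measure (Rd d)) [IsFiniteMeasure μ] {φ : Rd d → ℂ}
    (hφ : Integrable φ) : Integrable (convDensity μ φ) :=
  (integrable_convDensity_prod μ hφ).integral_prod_left

theorem convDensity_zero (μ : Measure (Rd d)) : convDensity μ (0 : Rd d → ℂ) = 0 := by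
  ext x; simp [convDensity]

theorem exists_norm_fourierFun_le {f : Rd d → ℂ} :
    ∃ c : ℝ, 0 ≤ c ∧ ∀ ξ, ‖fourierFun f ξ‖ ≤ c :=
  ⟨∫ x, ‖f x‖, integral_nonneg fun _ => norm_nonneg _, fun ξ => norm_hatOf_le volume f ξ⟩

theorem integrable_norm_fourierFun_sq_mul {ρ : Measure (Rd d)} {f : Rd d → ℂ} (hf : Integrable f)
    {w : Rd d → ℝ} (hw : Integrable w ρ) :
    Integrable (fun ξ => ‖fourierFun f ξ‖ ^ 2 * w ξ) ρ := by
  obtain ⟨c, hc0, hc⟩ := exists_norm_fourierFun_le (f := f)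
  refine hw.bdd_mul (c := c ^ 2) ((continuous_fourierFun hf).norm.pow 2).aestronglyMeasurable
    (Eventually.of_forall fun ξ => ?_)
  rw [norm_pow, norm_norm]
  exact pow_le_pow_left₀ (norm_nonneg _) (hc ξ) 2

/-- `M` bounds the quadratic form `∫ |f̂|² dμ` on test functions supported in `E`. -/
def IsRestrictionBound (μ : Measure (Rd d)) (p : ℝ) (E : Set (Rd d)) (M : ℝ) : Prop :=
  ∀ g, IsTest E g → ∫ ξ, ‖fourierFun g ξ‖ ^ 2 ∂μ ≤ M * pnorm p g ^ 2

theorem fourierFun_modulate (g : Rd d → ℂ) (ζ η : Rd d) :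
    fourierFun (fun x => eChar ζ x * g x) η = fourierFun g (ζ + η) := by
  simp only [fourierFun_eq]
  congr 1; ext x
  rw [eChar_add]; ring

/-- A restriction bound for `μ` is inherited by `|μ * φ|` when `‖φ‖₁ ≤ 1`. -/
theorem IsRestrictionBound.convolve {μ : Measure (Rd d)} [IsFiniteMeasure μ] {p M : ℝ}
    {E : Set (Rd d)} (hE : MeasurableSet E) (hE' : volume E ≠ ⊤)
    (hM : IsRestrictionBound μ p E M) (hM0 : 0 ≤ M) {φ : Rd d → ℂ} (hφ : Integrable φ)
    (hφ1 : ∫ x, ‖φ x‖ ≤ 1) {g : Rd d → ℂ} (hg : IsTest E g) :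
    ∫ ξ, ‖fourierFun g ξ‖ ^ 2 * ‖convDensity μ φ ξ‖ ≤ M * pnorm p g ^ 2 := by
  have hgi := hg.integrable hE hE'
  obtain ⟨c, hc0, hc⟩ := exists_norm_fourierFun_le (f := g)
  have hc2 : ∀ ξ, ‖‖fourierFun g ξ‖ ^ 2‖ ≤ c ^ 2 := fun ξ => by
    rw [norm_pow, norm_norm]
    exact pow_le_pow_left₀ (norm_nonneg _) (hc ξ) 2
  have hcont : Continuous fun ξ => ‖fourierFun g ξ‖ ^ 2 := (continuous_fourierFun hgi).norm.pow 2
  have hI1 : Integrable (fun q : Rd d × Rd d => ‖fourierFun g q.1‖ ^ 2 * ‖φ (q.1 - q.2)‖)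
      ((volume : Measure (Rd d)).prod μ) :=
    (integrable_convDensity_prod μ hφ).norm.bdd_mul (c := c ^ 2)
      (hcont.comp continuous_fst).aestronglyMeasurable (Eventually.of_forall fun _ => hc2 _)
  have hI2 : Integrable (fun q : Rd d × Rd d => ‖fourierFun g (q.1 + q.2)‖ ^ 2 * ‖φ q.1‖)
      ((volume : Measure (Rd d)).prod μ) := by
    have h1 : Integrable (fun q : Rd d × Rd d => ‖φ q.1‖) ((volume : Measure (Rd d)).prod μ) :=
      hφ.norm.comp_fst μ
    exact h1.bdd_mul (c := c ^ 2) (hcont.comp (continuous_fst.add continuous_snd)).aestronglyMeasurable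
      (Eventually.of_forall fun _ => hc2 _)
  calc ∫ ξ, ‖fourierFun g ξ‖ ^ 2 * ‖convDensity μ φ ξ‖
      ≤ ∫ ξ, ∫ η, ‖fourierFun g ξ‖ ^ 2 * ‖φ (ξ - η)‖ ∂μ := by
        refine integral_mono (integrable_norm_fourierFun_sq_mul hgi
          (integrable_convDensity μ hφ).norm) hI1.integral_prod_left fun ξ => ?_
        dsimp only
        rw [integral_const_mul]
        exact mul_le_mul_of_nonneg_left (norm_integral_le_integral_norm _) (by positivity)
    _ = ∫ η, (∫ ξ, ‖fourierFun g ξ‖ ^ 2 * ‖φ (ξ - η)‖) ∂μ := integral_integral_swap hI1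
    _ = ∫ η, (∫ ζ, ‖fourierFun g (ζ + η)‖ ^ 2 * ‖φ ζ‖) ∂μ := by
        congr 1; ext η
        rw [← integral_add_right_eq_self _ η]
        simp
    _ = ∫ ζ, ∫ η, ‖fourierFun g (ζ + η)‖ ^ 2 * ‖φ ζ‖ ∂μ := (integral_integral_swap hI2).symm
    _ ≤ ∫ ζ, (M * pnorm p g ^ 2) * ‖φ ζ‖ := by
        refine integral_mono hI2.integral_prod_left (hφ.norm.const_mul _) fun ζ => ?_
        dsimp only
        rw [integral_mul_const]
        refine mul_le_mul_of_nonneg_right ?_ (norm_nonneg _)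
        -- A translate of `ĝ` is the Fourier transform of a modulation of `g`, which has the same
        -- modulus and is again a test function on `E`; so the bound `M` applies uniformly in `ζ`.
        have hn : ∀ x, ‖eChar ζ x * g x‖ = ‖g x‖ := fun x => by
          rw [norm_mul, norm_eChar, one_mul]
        have ht : IsTest E (fun x => eChar ζ x * g x) := hg.of_norm_eq
          ((continuous_eChar.comp (Continuous.prodMk_right ζ)).measurable.mul hg.meas) hn
        have := hM _ ht
        simpa only [fourierFun_modulate, pnorm, hn] using this
    _ ≤ M * pnorm p g ^ 2 := by
        rw [integral_const_mul]
        exact mul_le_of_le_one_right (by positivity) hφ1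

/-- Cauchy–Schwarz with weight `|m|` on the frequency side. Each factor can then be estimated in a
different way. -/
theorem norm_form_fourierFun_le {m f g : Rd d → ℂ} (hm : Integrable m) (hf : Integrable f)
    (hg : Integrable g) :
    ‖form (fourierFun m) f g‖ ≤ √(∫ ξ, ‖fourierFun f ξ‖ ^ 2 * ‖m ξ‖) *
      √(∫ ξ, ‖fourierFun g ξ‖ ^ 2 * ‖m ξ‖) := by
  have hs : ∀ u : Rd d → ℂ, ∀ ξ, (‖fourierFun u ξ‖ * √‖m ξ‖) ^ 2
      = ‖fourierFun u ξ‖ ^ 2 * ‖m ξ‖ := fun u ξ => by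
    rw [mul_pow, Real.sq_sqrt (norm_nonneg _)]
  have hmeas : ∀ u : Rd d → ℂ, Integrable u →
      AEStronglyMeasurable (fun ξ => ‖fourierFun u ξ‖ * √‖m ξ‖) volume := fun u hu =>
    (continuous_fourierFun hu).norm.aestronglyMeasurable.mul
      (Real.continuous_sqrt.comp_aestronglyMeasurable hm.1.norm)
  have h := integral_mul_le_sqrt_mul_sqrt (ρ := volume)
    (u := fun ξ => ‖fourierFun f ξ‖ * √‖m ξ‖) (v := fun ξ => ‖fourierFun g ξ‖ * √‖m ξ‖)
    (fun _ => by positivity) (fun _ => by positivity) (hmeas f hf) (hmeas g hg)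
    (by simpa only [hs] using integrable_norm_fourierFun_sq_mul hf hm.norm)
    (by simpa only [hs] using integrable_norm_fourierFun_sq_mul hg hm.norm)
  simp only [hs] at h
  refine le_trans ?_ h
  rw [show fourierFun m = hatOf volume m from rfl, form_hatOf hm hf hg]
  refine (norm_integral_le_integral_norm _).trans (le_of_eq ?_)
  congr 1; ext ξ
  rw [norm_mul, norm_mul, RCLike.norm_conj, mul_mul_mul_comm, Real.mul_self_sqrt (norm_nonneg _)]

theorem integral_norm_fourierFun_sq_mul_le {m f : Rd d → ℂ} (hm : Integrable m) {D : ℝ}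
    (hmD : ∀ᵐ ξ, ‖m ξ‖ ≤ D) (hf : Integrable f) (hf2 : MemLp f 2) :
    ∫ ξ, ‖fourierFun f ξ‖ ^ 2 * ‖m ξ‖ ≤ D * ((2 * Real.pi) ^ d * ∫ x, ‖f x‖ ^ 2) := by
  obtain ⟨h1, h2⟩ := memLp_fourierFun hf hf2
  rw [← h2, ← integral_const_mul]
  refine integral_mono_ae (integrable_norm_fourierFun_sq_mul hf hm.norm) (h1.const_mul _) ?_
  filter_upwards [hmD] with ξ hξ
  rw [mul_comm]
  exact mul_le_mul_of_nonneg_right hξ (by positivity)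

/-- The `L^p` bound for the dyadic sum, given a restriction bound `M` for `μ`. -/
theorem norm_form_fourierCM_le {p a b A M α β σ : ℝ} (hα : 0 < α) (ha : α ≤ a)
    (hb : α ≤ b) (haβ : a ≤ β) (hp1 : 1 ≤ p) (hp2 : p ≤ 2) (hσ : 0 < σ)
    (hσb : σ * (p - 1) = b / 2) (hσa : σ * (2 - p) = a) (hA : 0 ≤ A) (hAM : A ≤ M)
    {E : Set (Rd d)} (hE : MeasurableSet E) (hE' : volume E ≠ ⊤)
    {μ : Measure (Rd d)} [IsFiniteMeasure μ] (hM : IsRestrictionBound μ p E M)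
    {ν : ComplexMeasure (Rd d)} {φ : ℕ → Rd d → ℂ}
    (hφ : ∀ j, Integrable (φ j)) (hφ1 : ∀ j, ∫ x, ‖φ j x‖ ≤ 1)
    (hsup : ∀ j : ℕ, ∀ᵐ ξ, ‖convDensity μ (φ j) ξ‖ ≤ A * 2 ^ (j * a))
    (hdec : ∀ (j : ℕ) ξ, ‖fourierFun (convDensity μ (φ j)) ξ‖ ≤ A * 2 ^ (-(j * b)))
    (hsum : ∀ ξ, HasSum (fun j => fourierFun (convDensity μ (φ j)) ξ) (fourierCM ν ξ))
    (hs : Summable fun j : ℕ => A * (2 : ℝ) ^ (-(j * b)))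
    {f g : Rd d → ℂ} (hf : IsTest E f) (hg : IsTest E g) :
    ‖form (fourierCM ν) f g‖ ≤
      √((2 * Real.pi) ^ d * A * M) * 2 ^ (β / 2) * decaySum α ^ 2 * pnorm p f * pnorm p g := by
  have hM0 : 0 ≤ M := hA.trans hAM
  have hm := fun j => integrable_convDensity μ (hφ j)
  have hk := fun j => continuous_fourierFun (hm j)
  have hpi : (1 : ℝ) ≤ (2 * Real.pi) ^ d := one_le_pow₀ (by linarith [Real.pi_gt_three])
  -- One constant has to serve in all three bounds; this is where `A ≤ M` is needed.
  have hAB : A ≤ √((2 * Real.pi) ^ d * A * M) := by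
    refine Real.le_sqrt_of_sq_le ?_
    rw [sq, mul_assoc]
    calc A * A ≤ A * M := mul_le_mul_of_nonneg_left hAM hA
      _ ≤ _ := le_mul_of_one_le_left (mul_nonneg hA hM0) hpi
  have hL2 : ∀ F, IsTest E F → MemLp F 2 := fun F hF =>
    (memLp_two_iff_integrable_sq_norm hF.meas.aestronglyMeasurable).2 (hF.integrable_sq hE hE')
  have hS2 : ∀ (j : ℕ) F, IsTest E F → √(∫ ξ, ‖fourierFun F ξ‖ ^ 2 * ‖convDensity μ (φ j) ξ‖) ≤
      √((2 * Real.pi) ^ d * A) * 2 ^ (j * a / 2) * √(∫ x, ‖F x‖ ^ 2) := by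
    intro j F hF
    refine (Real.sqrt_le_sqrt (integral_norm_fourierFun_sq_mul_le (hm j) (hsup j)
      (hF.integrable hE hE') (hL2 F hF))).trans (le_of_eq ?_)
    have e : (2 : ℝ) ^ (j * a / 2) = √(2 ^ (j * a)) := by
      rw [Real.sqrt_eq_rpow, ← Real.rpow_mul two_pos.le]; congr 1; ring
    rw [e, ← Real.sqrt_mul (by positivity), ← Real.sqrt_mul (by positivity)]
    congr 1; ring
  have hSM : ∀ (j : ℕ) F, IsTest E F → √(∫ ξ, ‖fourierFun F ξ‖ ^ 2 * ‖convDensity μ (φ j) ξ‖) ≤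
      √M * pnorm p F := by
    intro j F hF
    refine (Real.sqrt_le_sqrt (hM.convolve hE hE' hM0 (hφ j) (hφ1 j) hF)).trans (le_of_eq ?_)
    rw [Real.sqrt_mul hM0, Real.sqrt_sq (pnorm_nonneg _ _)]
  have hB : √((2 * Real.pi) ^ d * A * M) = √((2 * Real.pi) ^ d * A) * √M :=
    Real.sqrt_mul (by positivity) _
  have H := fun J : Finset ℕ => sum_norm_form_le hα ha hb haβ hp1 hp2 hσ hσb hσa hA hAB hE hE' hk
    hdec
    (fun j F G hF hG => norm_form_le (hdec j) (hF.integrable hE hE') (hG.integrable hE hE'))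
    (fun j F G hF hG => by
      refine (norm_form_fourierFun_le (hm j) (hF.integrable hE hE') (hG.integrable hE hE')).trans
        ((mul_le_mul (hS2 j F hF) (hSM j G hG) (Real.sqrt_nonneg _) (by positivity)).trans
        (le_of_eq ?_))
      rw [hB]; ring)
    (fun j F G hF hG => by
      refine (norm_form_fourierFun_le (hm j) (hF.integrable hE hE') (hG.integrable hE hE')).trans
        ((mul_le_mul (hSM j F hF) (hS2 j G hG) (Real.sqrt_nonneg _)
          (mul_nonneg (Real.sqrt_nonneg _) (pnorm_nonneg _ _))).trans (le_of_eq ?_))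
      rw [hB]; ring) hf hg J
  have hsf := hasSum_form hk hdec hs hsum (hf.integrable hE hE') (hg.integrable hE hE')
  exact le_of_tendsto hsf.tendsto_sum_nat.norm
    (Eventually.of_forall fun n => (norm_sum_le _ _).trans (H _))

end

/-! ### The bootstrap for the restriction constant. -/

section
variable {d : ℕ}

/-- The infimum of the admissible constants `M ≥ A` is itself admissible, so `h` applies to it and
it cannot exceed the improved constant. The a priori `M₀` only makes the set nonempty and leaves no
trace in the result. -/
theorem IsRestrictionBound.absorb {μ : Measure (Rd d)} {p A K M₀ : ℝ} {E : Set (Rd d)}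
    (hA : 0 ≤ A) (hM₀ : IsRestrictionBound μ p E M₀) (hAM₀ : A ≤ M₀)
    (h : ∀ M, A ≤ M → IsRestrictionBound μ p E M → IsRestrictionBound μ p E (A + K * √(A * M)))
    (hK : 0 ≤ K) : IsRestrictionBound μ p E ((2 + K ^ 2) * A) := by
  set S : Set ℝ := {M | A ≤ M ∧ IsRestrictionBound μ p E M}
  have hS : S.Nonempty := ⟨M₀, hAM₀, hM₀⟩
  have hbdd : BddBelow S := ⟨A, fun M hM => hM.1⟩
  have hAm : A ≤ sInf S := le_csInf hS fun M hM => hM.1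
  have hm : IsRestrictionBound μ p E (sInf S) := by
    intro g hg
    rcases (pnorm_nonneg p g).eq_or_lt' with h0 | h0
    · have := hM₀ g hg
      simpa [h0] using this
    · rw [← div_le_iff₀ (by positivity)]
      exact le_csInf hS fun M hM => (div_le_iff₀ (by positivity)).2 (hM.2 g hg)
  have hle : sInf S ≤ A + K * √(A * sInf S) :=
    csInf_le hbdd ⟨le_add_of_nonneg_right (by positivity), h _ hAm hm⟩
  -- With `m` the infimum, `K √(A m) ≤ (K² A + m)/2`, and `m/2` moves to the left-hand side.
  have hfin : sInf S ≤ (2 + K ^ 2) * A := by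
    rw [Real.sqrt_mul hA] at hle
    nlinarith [Real.sq_sqrt hA, Real.sq_sqrt (hA.trans hAm), sq_nonneg (K * √A - √(sInf S))]
  exact fun g hg => (hm g hg).trans (mul_le_mul_of_nonneg_right hfin (by positivity))

theorem eLpNorm_eq_pnorm {p : ℝ≥0∞} (hp1 : 1 ≤ p) (hp : p ≠ ⊤) {f : Rd d → ℂ}
    (hf : MemLp f p) : (eLpNorm f p volume).toReal = pnorm p.toReal f := by
  have hp0 : p ≠ 0 := (zero_lt_one.trans_le hp1).ne'
  rw [hf.eLpNorm_eq_integral_rpow_norm hp0 hp, pnorm, one_div, ENNReal.toReal_ofReal]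
  exact Real.rpow_nonneg (integral_nonneg fun x => by positivity) _

theorem IsTest.memLp {E : Set (Rd d)} {f : Rd d → ℂ} (hf : IsTest E f)
    (hE : MeasurableSet E) (hE' : volume E ≠ ⊤) {p : ℝ≥0∞} (hp1 : 1 ≤ p) (hp : p ≠ ⊤) :
    MemLp f p :=
  (integrable_norm_rpow_iff hf.meas.aestronglyMeasurable (zero_lt_one.trans_le hp1).ne' hp).1
    (hf.integrable_rpow hE hE' (ENNReal.toReal_pos (zero_lt_one.trans_le hp1).ne' hp))

/-- `|ĝ| ≤ ‖g‖₁ ≤ |E|^{1-1/p} ‖g‖_p` and `μ` has mass at most one. Only the finiteness of this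
constant matters. -/
theorem exists_isRestrictionBound {μ : Measure (Rd d)} (hμ : μ Set.univ ≤ 1) {p : ℝ≥0∞}
    (hp1 : 1 ≤ p) (hp : p ≠ ⊤) {E : Set (Rd d)} (hE : MeasurableSet E) (hE' : volume E ≠ ⊤) :
    ∃ M, ∀ M' ≥ M, IsRestrictionBound μ p.toReal E M' := by
  have : IsFiniteMeasure μ := ⟨hμ.trans_lt ENNReal.one_lt_top⟩
  set v : ℝ := (volume E ^ (1 - 1 / p.toReal)).toReal
  have hexp : 0 ≤ 1 - 1 / p.toReal := by
    rw [sub_nonneg, div_le_one (ENNReal.toReal_pos (zero_lt_one.trans_le hp1).ne' hp)]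
    simpa using ENNReal.toReal_mono hp hp1
  refine ⟨v ^ 2, fun M hM g hg => ?_⟩
  have hgi := hg.integrable hE hE'
  have hgp := hg.memLp hE hE' hp1 hp
  have h1 : ∫ x, ‖g x‖ ≤ pnorm p.toReal g * v := by
    have hr : ∀ q : ℝ≥0∞, eLpNorm g q volume = eLpNorm g q (volume.restrict E) := fun q => by
      rw [← eLpNorm_indicator_eq_eLpNorm_restrict hE]
      congr 1
      exact (Set.indicator_eq_self.2 fun x hx => by_contra fun h => hx (hg.supp x h)).symm
    have h2 := eLpNorm_le_eLpNorm_mul_rpow_measure_univ (μ := volume.restrict E) hp1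
      (hg.meas.aestronglyMeasurable (μ := volume.restrict E))
    rw [← hr, ← hr, Measure.restrict_apply_univ, ENNReal.toReal_one, div_one] at h2
    have h3 := ENNReal.toReal_mono
      (ENNReal.mul_ne_top hgp.2.ne (ENNReal.rpow_ne_top_of_nonneg hexp hE')) h2
    rwa [ENNReal.toReal_mul, eLpNorm_eq_pnorm hp1 hp hgp, eLpNorm_one_eq_lintegral_enorm,
      ← integral_norm_eq_lintegral_enorm hgi.1] at h3
  calc ∫ ξ, ‖fourierFun g ξ‖ ^ 2 ∂μ ≤ ∫ _, (pnorm p.toReal g * v) ^ 2 ∂μ := by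
        refine integral_mono (by
          simpa using integrable_norm_fourierFun_sq_mul hgi (integrable_const (μ := μ) (1 : ℝ)))
          (integrable_const _) fun ξ => ?_
        exact pow_le_pow_left₀ (norm_nonneg _) ((norm_hatOf_le volume g ξ).trans h1) 2
    _ ≤ (pnorm p.toReal g * v) ^ 2 := by
        rw [integral_const, smul_eq_mul]
        refine mul_le_of_le_one_left (by positivity) ?_
        exact ENNReal.toReal_mono ENNReal.one_ne_top hμ
    _ ≤ M * pnorm p.toReal g ^ 2 := by
        rw [mul_pow, mul_comm]
        exact mul_le_mul_of_nonneg_right hM (by positivity)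

/-- Hölder's inequality applied to `T_ν(conj f)` and `g`. -/
theorem ConvBounded.norm_form_le {ν : ComplexMeasure (Rd d)} {p q : ℝ≥0∞} [Fact (1 ≤ p)]
    [Fact (1 ≤ q)] {A : ℝ} (h : ConvBounded ν p q A) (hp : p ≠ ⊤) (hpq : p⁻¹ + q⁻¹ = 1)
    {f g : Rd d → ℂ} (hf : Integrable f) (hg : Integrable g) (hfp : MemLp f p) (hgp : MemLp g p) :
    ‖form (fourierCM ν) f g‖ ≤ A * pnorm p.toReal f * pnorm p.toReal g := by
  have hp1 : 1 ≤ p := Fact.out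
  obtain ⟨S, hS, hSA⟩ := h
  have hcp : MemLp (fun x => conj (f x)) p := hfp.star
  have hS' := hS _ (memLp_one_iff_integrable.2 (integrable_conj hf)) hcp
  set u := S (hcp.toLp fun x => conj (f x))
  have : ENNReal.HolderTriple q p 1 := ⟨by rw [add_comm, hpq, inv_one]⟩
  rw [← integral_convOp_mul ν hf hg]
  have hH := eLpNorm_smul_le_mul_eLpNorm (p := q) (q := p) (r := 1) hgp.1 (Lp.memLp u).1
  have hfin : eLpNorm u q volume * eLpNorm g p volume ≠ ⊤ :=
    ENNReal.mul_ne_top (Lp.memLp u).2.ne hgp.2.ne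
  have hnorm : ‖hcp.toLp fun x => conj (f x)‖ = pnorm p.toReal f := by
    rw [Lp.norm_toLp, eLpNorm_eq_pnorm hp1 hp hcp]
    simp only [pnorm, RCLike.norm_conj]
  calc ‖∫ y, convOp ν (fun x => conj (f x)) y * g y‖
      = ‖∫ y, ((u : Rd d → ℂ) • g) y‖ := by
        congr 1
        refine integral_congr_ae ?_
        filter_upwards [hS'] with y hy
        rw [Pi.smul_apply', hy, smul_eq_mul]
    _ ≤ (eLpNorm ((u : Rd d → ℂ) • g) 1 volume).toReal := by
        refine (norm_integral_le_lintegral_norm _).trans (le_of_eq ?_)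
        rw [eLpNorm_one_eq_lintegral_enorm]
        simp only [ofReal_norm]
    _ ≤ (eLpNorm u q volume * eLpNorm g p volume).toReal := ENNReal.toReal_mono hfin hH
    _ = ‖u‖ * pnorm p.toReal g := by
        rw [ENNReal.toReal_mul, eLpNorm_eq_pnorm hp1 hp hgp, Lp.norm_def]
    _ ≤ _ := by
        refine mul_le_mul_of_nonneg_right ?_ (pnorm_nonneg _ _)
        rw [← hnorm]; exact hSA _

/-- The decomposition `ν = ∑_j μ * φ_j` together with the size and decay bounds. -/
structure IsDyadicSum (μ : Measure (Rd d)) (A a b : ℝ) (ν : ComplexMeasure (Rd d))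
    (φ : ℕ → Rd d → ℂ) : Prop where
  integrable : ∀ j, Integrable (φ j)
  norm_le : ∀ j, ∫ x, ‖φ j x‖ ≤ 1
  sup_le : ∀ j : ℕ, ∀ᵐ ξ, ‖convDensity μ (φ j) ξ‖ ≤ A * 2 ^ (j * a)
  fourier_le : ∀ (j : ℕ) ξ, ‖fourierFun (convDensity μ (φ j)) ξ‖ ≤ A * 2 ^ (-(j * b))
  hasSum : ∀ ξ, HasSum (fun j => fourierFun (convDensity μ (φ j)) ξ) (fourierCM ν ξ)

theorem summable_geometric_two_rpow {b : ℝ} (hb : 0 < b) (A : ℝ) :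
    Summable fun j : ℕ => A * (2 : ℝ) ^ (-(j * b)) := by
  refine Summable.mul_left A ?_
  have : (fun n : ℕ => (2 : ℝ) ^ (-((n : ℝ) * b))) = fun n : ℕ => ((2 : ℝ) ^ (-b)) ^ n := by
    ext n; rw [← Real.rpow_mul_natCast two_pos.le]; ring_nf
  rw [this]
  exact summable_geometric_of_lt_one (by positivity)
    (Real.rpow_lt_one_of_one_lt_of_neg one_lt_two (by linarith))

/-- The constant in the bound for the form of a dyadic sum. -/
noncomputable def formConst (d : ℕ) (α β : ℝ) : ℝ :=
  √((2 * Real.pi) ^ d) * 2 ^ (β / 2) * decaySum α ^ 2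

theorem formConst_nonneg (d : ℕ) (α β : ℝ) : 0 ≤ formConst d α β := by
  unfold formConst; positivity

theorem IsDyadicSum.norm_form_le {p a b A M α β : ℝ} (hα : 0 < α) (ha : a ∈ Set.Icc α β)
    (hb : b ∈ Set.Icc α β) (hp : p = 2 * ((a + b) / (2 * a + b))) (hA : 0 ≤ A) (hAM : A ≤ M)
    {E : Set (Rd d)} (hE : MeasurableSet E) (hE' : volume E ≠ ⊤)
    {μ : Measure (Rd d)} [IsFiniteMeasure μ] (hM : IsRestrictionBound μ p E M)
    {ν : ComplexMeasure (Rd d)} {φ : ℕ → Rd d → ℂ} (h : IsDyadicSum μ A a b ν φ)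
    {f g : Rd d → ℂ} (hf : IsTest E f) (hg : IsTest E g) :
    ‖form (fourierCM ν) f g‖ ≤ formConst d α β * √(A * M) * pnorm p f * pnorm p g := by
  have ha0 : 0 < a := hα.trans_le ha.1
  have hb0 : 0 < b := hα.trans_le hb.1
  have hab : 2 * a + b ≠ 0 := by positivity
  -- Here `p - 1 = b/(2a + b)` and `2 - p = 2a/(2a + b)`, so one `σ = (2a + b)/2` meets both
  -- requirements; the exponent `p` is the one that makes them compatible.
  have hσb : (2 * a + b) / 2 * (p - 1) = b / 2 := by rw [hp]; field_simp; ring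
  have hσa : (2 * a + b) / 2 * (2 - p) = a := by rw [hp]; field_simp; ring
  have hσ : 0 < (2 * a + b) / 2 := by positivity
  have hp1 : 1 ≤ p := by nlinarith
  have hp2 : p ≤ 2 := by nlinarith
  have := norm_form_fourierCM_le hα ha.1 hb.1 ha.2 hp1 hp2 hσ hσb hσa hA hAM hE hE' hM
    h.integrable h.norm_le h.sup_le h.fourier_le h.hasSum (summable_geometric_two_rpow hb0 A) hf hg
  refine this.trans (le_of_eq ?_)
  rw [mul_assoc ((2 * Real.pi) ^ d), Real.sqrt_mul (by positivity), formConst]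
  ring

theorem form_fourier_measure {μ : Measure (Rd d)} [IsFiniteMeasure μ] {f : Rd d → ℂ}
    (hf : Integrable f) :
    ∫ ξ, ‖fourierFun f ξ‖ ^ 2 ∂μ = ‖form (fun ξ => ∫ x, eChar ξ x ∂μ) f f‖ := by
  have h := form_hatOf (ρ := μ) (m := fun _ => 1) (integrable_const 1) hf hf
  have h1 : hatOf μ (fun _ => 1) = fun ξ => ∫ x, eChar ξ x ∂μ := by
    ext ξ; simp [hatOf]
  have h2 : ∀ ξ, conj (fourierFun f ξ) * fourierFun f ξ * 1 =
      ((‖fourierFun f ξ‖ ^ 2 : ℝ) : ℂ) := fun ξ => by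
    rw [mul_one, Complex.conj_mul']; norm_cast
  rw [← h1, h]
  simp only [h2]
  rw [integral_complex_ofReal, Complex.norm_real, Real.norm_of_nonneg]
  exact integral_nonneg fun ξ => by positivity

/-- The constant in the restriction bound. -/
noncomputable def restrConst (d N : ℕ) (α β : ℝ) : ℝ := 2 + (N * formConst d α β) ^ 2

/-- Split the diagonal form of `μ̂` into the part from `μb`, bounded by `A`, and `N` dyadic sums,
each bounded by a multiple of `√(A M)`; then absorb. -/
theorem isRestrictionBound_restrConst {N : ℕ} {α β : ℝ} (hα : 0 < α) {p q : ℝ≥0∞}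
    [Fact (1 ≤ p)] [Fact (1 ≤ q)] (hp : p ≠ ⊤) (hpq : p⁻¹ + q⁻¹ = 1)
    {μ : Measure (Rd d)} (hμ : μ Set.univ ≤ 1) {μb : ComplexMeasure (Rd d)}
    {μi : Fin N → ComplexMeasure (Rd d)}
    (hdec : ∀ s : Set (Rd d), MeasurableSet s → ((μ s).toReal : ℂ) = μb s + ∑ i, μi i s)
    {A : ℝ} (hA : 0 ≤ A) (hb : ConvBounded μb p q A) {φ : Fin N → ℕ → Rd d → ℂ}
    {a b : Fin N → ℝ} (hab : ∀ i, a i ∈ Set.Icc α β ∧ b i ∈ Set.Icc α β)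
    (hpab : ∀ i, p.toReal = 2 * ((a i + b i) / (2 * a i + b i)))
    (hi : ∀ i, IsDyadicSum μ A (a i) (b i) (μi i) (φ i))
    {E : Set (Rd d)} (hE : MeasurableSet E) (hE' : volume E ≠ ⊤) :
    IsRestrictionBound μ p.toReal E (restrConst d N α β * A) := by
  have : IsFiniteMeasure μ := ⟨hμ.trans_lt ENNReal.one_lt_top⟩
  have hp1 : 1 ≤ p := Fact.out
  obtain ⟨M₀, hM₀⟩ := exists_isRestrictionBound hμ hp1 hp hE hE'
  refine IsRestrictionBound.absorb hA (hM₀ (max A M₀) (le_max_right _ _)) (le_max_left _ _)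
    (fun M hAM hM g hg => ?_) (mul_nonneg (Nat.cast_nonneg N) (formConst_nonneg d α β))
  have hgi := hg.integrable hE hE'
  have hgp := hg.memLp hE hE' hp1 hp
  obtain ⟨cb, hcb⟩ := exists_norm_fourierCM_le μb
  choose c hc using fun i => exists_norm_fourierCM_le (μi i)
  rw [form_fourier_measure hgi]
  simp only [fourierCM_decomp μ μb μi hdec]
  rw [form_add_kernel Finset.univ (continuous_fourierCM μb) hcb
    (fun i => continuous_fourierCM (μi i)) hc hgi hgi]
  calc _ ≤ ‖form (fourierCM μb) g g‖ + ∑ i, ‖form (fourierCM (μi i)) g g‖ :=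
        (norm_add_le _ _).trans (add_le_add_right (norm_sum_le _ _) _)
    _ ≤ A * pnorm p.toReal g * pnorm p.toReal g + ∑ _i : Fin N,
        formConst d α β * √(A * M) * pnorm p.toReal g * pnorm p.toReal g :=
        add_le_add (hb.norm_form_le hp hpq hgi hgi hgp hgp) (Finset.sum_le_sum fun i _ =>
          (hi i).norm_form_le hα (hab i).1 (hab i).2 (hpab i) hA hAM hE hE' hM hg hg)
    _ = _ := by
        rw [Finset.sum_const, Finset.card_univ, Fintype.card_fin, nsmul_eq_mul]
        ring

end

/-! ### From test functions to `L¹ ∩ L^p`, and duality. -/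

section
variable {d : ℕ}

theorem IsTest.mono {E E' : Set (Rd d)} {f : Rd d → ℂ} (hf : IsTest E f) (h : E ⊆ E') :
    IsTest E' f :=
  ⟨hf.meas, fun x hx => hf.supp x fun hx' => hx (h hx'), hf.bdd⟩

/-- The part of `f` where `1/(n+1) ≤ |f| ≤ n+1`. -/
noncomputable def truncate (f : Rd d → ℂ) (n : ℕ) (x : Rd d) : ℂ :=
  if ((n : ℝ) + 1)⁻¹ ≤ ‖f x‖ ∧ ‖f x‖ ≤ (n : ℝ) + 1 then f x else 0

theorem measurable_truncate {f : Rd d → ℂ} (hf : Measurable f) (n : ℕ) :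
    Measurable (truncate f n) :=
  Measurable.ite ((measurableSet_le measurable_const hf.norm).inter
    (measurableSet_le hf.norm measurable_const)) hf measurable_const

theorem isTest_truncate {f : Rd d → ℂ} (hf : Measurable f) (n : ℕ) :
    IsTest {x | ((n : ℝ) + 1)⁻¹ ≤ ‖f x‖} (truncate f n) := by
  refine ⟨measurable_truncate hf n, fun x hx => ?_, n, fun x => ?_⟩
  · exact if_neg fun h => hx h.1
  · unfold truncate
    split_ifs with h
    · exact Or.inr h
    · exact Or.inl rfl

theorem norm_truncate_le (f : Rd d → ℂ) (n : ℕ) (x : Rd d) : ‖truncate f n x‖ ≤ ‖f x‖ := by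
  unfold truncate; split_ifs <;> simp

theorem tendsto_truncate (f : Rd d → ℂ) (x : Rd d) :
    Tendsto (fun n => truncate f n x) atTop (𝓝 (f x)) := by
  by_cases hx : f x = 0
  · have : ∀ n, truncate f n x = 0 := fun n => by
      rw [← norm_le_zero_iff, ← norm_zero (E := ℂ), ← hx]; exact norm_truncate_le f n x
    simp [this, hx]
  · have hpos : 0 < ‖f x‖ := norm_pos_iff.2 hx
    obtain ⟨N, hN⟩ := exists_nat_ge (max ‖f x‖ ‖f x‖⁻¹)
    refine tendsto_const_nhds.congr' ?_
    filter_upwards [eventually_ge_atTop N] with n hn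
    have hn' : (N : ℝ) ≤ n := by exact_mod_cast hn
    rw [truncate, if_pos]
    constructor
    · rw [inv_le_comm₀ (by positivity) hpos]
      linarith [(le_max_right ‖f x‖ ‖f x‖⁻¹).trans hN]
    · linarith [(le_max_left ‖f x‖ ‖f x‖⁻¹).trans hN]

theorem measurableSet_le_norm {f : Rd d → ℂ} (hf : Measurable f) (c : ℝ) :
    MeasurableSet {x | c ≤ ‖f x‖} := measurableSet_le measurable_const hf.norm

theorem volume_le_norm_ne_top {f : Rd d → ℂ} (hf : Integrable f) (n : ℕ) :
    volume {x | ((n : ℝ) + 1)⁻¹ ≤ ‖f x‖} ≠ ⊤ :=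
  (hf.measure_norm_ge_lt_top (by positivity)).ne

theorem pnorm_truncate_le {p : ℝ} (hp : 0 < p) {f : Rd d → ℂ}
    (hfp : Integrable fun x => ‖f x‖ ^ p) (n : ℕ) : pnorm p (truncate f n) ≤ pnorm p f := by
  refine Real.rpow_le_rpow (integral_nonneg fun x => by positivity) ?_ (by positivity)
  refine integral_mono_of_nonneg (Eventually.of_forall fun x => by positivity) hfp
    (Eventually.of_forall fun x => ?_)
  exact Real.rpow_le_rpow (norm_nonneg _) (norm_truncate_le f n x) hp.le

/-- Each truncation is a test function on a set of finite measure that grows with `n`, so it is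
essential that `M` is the same for all `E`. Dominated convergence does the rest. -/
theorem integral_norm_fourierFun_sq_le {μ : Measure (Rd d)} [IsFiniteMeasure μ] {p M : ℝ}
    (hp : 0 < p) (hM0 : 0 ≤ M)
    (hM : ∀ E, MeasurableSet E → volume E ≠ ⊤ → IsRestrictionBound μ p E M) {f : Rd d → ℂ}
    (hfm : Measurable f) (hf : Integrable f) (hfp : Integrable fun x => ‖f x‖ ^ p) :
    ∫ ξ, ‖fourierFun f ξ‖ ^ 2 ∂μ ≤ M * pnorm p f ^ 2 := by
  have hbd : ∀ n ξ, ‖fourierFun (truncate f n) ξ‖ ≤ ∫ x, ‖f x‖ := fun n ξ =>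
    (norm_hatOf_le volume _ ξ).trans (integral_mono_of_nonneg
      (Eventually.of_forall fun x => norm_nonneg _) hf.norm
      (Eventually.of_forall (norm_truncate_le f n)))
  have hti : ∀ n, Integrable (truncate f n) := fun n =>
    (isTest_truncate hfm n).integrable (measurableSet_le_norm hfm _) (volume_le_norm_ne_top hf n)
  have hlim : ∀ ξ, Tendsto (fun n => fourierFun (truncate f n) ξ) atTop (𝓝 (fourierFun f ξ)) := by
    intro ξ
    refine tendsto_integral_of_dominated_convergence (fun x => ‖f x‖)
      (fun n => (integrable_eChar_mul (hti n) ξ).1) hf.norm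
      (fun n => Eventually.of_forall fun x => ?_)
      (Eventually.of_forall fun x => (tendsto_truncate f x).const_mul _)
    rw [norm_mul, ← eChar, norm_eChar, one_mul]
    exact norm_truncate_le f n x
  have hL : Tendsto (fun n => ∫ ξ, ‖fourierFun (truncate f n) ξ‖ ^ 2 ∂μ) atTop
      (𝓝 (∫ ξ, ‖fourierFun f ξ‖ ^ 2 ∂μ)) := by
    refine tendsto_integral_of_dominated_convergence (fun _ => (∫ x, ‖f x‖) ^ 2)
      (fun n => ((continuous_fourierFun (hti n)).norm.pow 2).aestronglyMeasurable)
      (integrable_const _) (fun n => Eventually.of_forall fun ξ => ?_)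
      (Eventually.of_forall fun ξ => (hlim ξ).norm.pow 2)
    rw [norm_pow, norm_norm]
    exact pow_le_pow_left₀ (norm_nonneg _) (hbd n ξ) 2
  refine le_of_tendsto hL (Eventually.of_forall fun n => ?_)
  refine (hM _ (measurableSet_le_norm hfm _) (volume_le_norm_ne_top hf n) _
    (isTest_truncate hfm n)).trans ?_
  exact mul_le_mul_of_nonneg_left (pow_le_pow_left₀ (pnorm_nonneg _ _)
    (pnorm_truncate_le hp hfp n) 2) hM0

theorem norm_form_le_of_isTest {k : Rd d → ℂ} {c p K : ℝ} (hp : 0 < p) (hK0 : 0 ≤ K)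
    (hk : Continuous k) (hc : ∀ x, ‖k x‖ ≤ c)
    (hK : ∀ E, MeasurableSet E → volume E ≠ ⊤ → ∀ f g, IsTest E f → IsTest E g →
      ‖form k f g‖ ≤ K * pnorm p f * pnorm p g) {f g : Rd d → ℂ}
    (hfm : Measurable f) (hf : Integrable f) (hfp : Integrable fun x => ‖f x‖ ^ p)
    (hgm : Measurable g) (hg : Integrable g) (hgp : Integrable fun x => ‖g x‖ ^ p) :
    ‖form k f g‖ ≤ K * pnorm p f * pnorm p g := by
  have hti : ∀ {u : Rd d → ℂ}, Measurable u → Integrable u → ∀ n, Integrable (truncate u n) :=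
    fun hum hu n => (isTest_truncate hum n).integrable (measurableSet_le_norm hum _)
      (volume_le_norm_ne_top hu n)
  have hL : Tendsto (fun n => form k (truncate f n) (truncate g n)) atTop (𝓝 (form k f g)) := by
    refine tendsto_integral_of_dominated_convergence (fun p => c * (‖f p.1‖ * ‖g p.2‖))
      (fun n => (integrable_form hk hc (hti hfm hf n) (hti hgm hg n)).1)
      ((hf.norm.mul_prod hg.norm).const_mul c) (fun n => Eventually.of_forall fun p => ?_)
      (Eventually.of_forall fun p => ?_)
    · rw [norm_mul, norm_mul, RCLike.norm_conj, mul_comm]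
      gcongr
      · exact (norm_nonneg _).trans (hc 0)
      · exact hc _
      · exact norm_truncate_le f n _
      · exact norm_truncate_le g n _
    · exact (((Complex.continuous_conj.tendsto _).comp (tendsto_truncate f p.1)).mul
        (tendsto_truncate g p.2)).mul_const _
  refine le_of_tendsto hL.norm (Eventually.of_forall fun n => ?_)
  have hE := (measurableSet_le_norm hfm ((n : ℝ) + 1)⁻¹).union
    (measurableSet_le_norm hgm ((n : ℝ) + 1)⁻¹)
  refine (hK _ hE (measure_union_ne_top (volume_le_norm_ne_top hf n) (volume_le_norm_ne_top hg n))
    _ _ ((isTest_truncate hfm n).mono Set.subset_union_left)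
    ((isTest_truncate hgm n).mono Set.subset_union_right)).trans ?_
  have h1 := pnorm_truncate_le hp hfp n
  have h2 := pnorm_truncate_le hp hgp n
  have h3 := pnorm_nonneg p (truncate g n)
  have h4 := pnorm_nonneg p f
  gcongr

/-- Converse Hölder inequality for bounded continuous functions. -/
theorem eLpNorm_le_of_forall_norm_integral_mul_le {F : Rd d → ℂ} {c p q K : ℝ}
    (hF : Continuous F) (hc : ∀ x, ‖F x‖ ≤ c) (hpq : p.HolderConjugate q) (hq : 2 ≤ q)
    (hK0 : 0 ≤ K)
    (h : ∀ g : Rd d → ℂ, Measurable g → Integrable g → Integrable (fun x => ‖g x‖ ^ p) →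
      ‖∫ x, F x * g x‖ ≤ K * pnorm p g) :
    eLpNorm F (ENNReal.ofReal q) volume ≤ ENNReal.ofReal K := by
  have hq0 : 0 < q := by linarith
  have hp0 : 0 < p := hpq.pos
  have hc0 : 0 ≤ c := (norm_nonneg _).trans (hc 0)
  set B : ℕ → Set (Rd d) := fun n => Metric.ball 0 n
  have hB : ∀ n, MeasurableSet (B n) := fun n => measurableSet_ball
  have hBt : ∀ n, volume (B n) ≠ ⊤ := fun n => measure_ball_lt_top.ne
  have hind : ∀ n (G : Rd d → ℝ), Measurable G → (∃ L, ∀ x, ‖G x‖ ≤ L) →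
      IntegrableOn G (B n) := fun n G hG ⟨L, hL⟩ =>
    Measure.integrableOn_of_bounded (hBt n) hG.aestronglyMeasurable (Eventually.of_forall hL)
  have hmF : Measurable fun x => ‖F x‖ := hF.measurable.norm
  have hbound : ∀ {r : ℝ}, 0 ≤ r → ∀ x, ‖‖F x‖ ^ r‖ ≤ c ^ r := fun {r} hr x => by
    rw [Real.norm_of_nonneg (by positivity)]
    exact Real.rpow_le_rpow (norm_nonneg _) (hc x) hr
  have key : ∀ n, ∫ x in B n, ‖F x‖ ^ q ≤ K ^ q := by
    intro n
    -- The extremizer for Hölder's inequality, cut off to a ball. The cutoff and the boundedness of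
    -- `F` make `I` below finite, so that one can divide by `I^{1/p}`.
    set g : Rd d → ℂ := (B n).indicator fun x => conj (F x) * ((‖F x‖ ^ (q - 2) : ℝ) : ℂ)
    have hgm : Measurable g := by
      refine Measurable.indicator ?_ (hB n)
      exact (Complex.continuous_conj.measurable.comp hF.measurable).mul
        (Complex.continuous_ofReal.measurable.comp (hmF.pow_const _))
    have hgn : ∀ x, ‖g x‖ = (B n).indicator (fun x => ‖F x‖ ^ (q - 1)) x := fun x => by
      by_cases hx : x ∈ B n
      · simp only [g, Set.indicator_of_mem hx]
        rw [norm_mul, RCLike.norm_conj, Complex.norm_real, Real.norm_of_nonneg (by positivity),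
          ← Real.rpow_one_add' (norm_nonneg _) (by linarith)]
        congr 1; ring
      · simp [g, Set.indicator_of_notMem hx]
    have hgp : ∀ x, ‖g x‖ ^ p = (B n).indicator (fun x => ‖F x‖ ^ q) x := fun x => by
      rw [hgn]
      by_cases hx : x ∈ B n
      · rw [Set.indicator_of_mem hx, Set.indicator_of_mem hx, ← Real.rpow_mul (norm_nonneg _)]
        congr 1
        linarith [hpq.mul_eq_add]
      · rw [Set.indicator_of_notMem hx, Set.indicator_of_notMem hx, Real.zero_rpow hp0.ne']
    have hgi : Integrable g := by
      rw [← integrable_norm_iff hgm.aestronglyMeasurable]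
      simp only [hgn]
      exact (integrable_indicator_iff (hB n)).2
        (hind n _ (hmF.pow_const _) ⟨_, hbound (by linarith)⟩)
    have hgpi : Integrable (fun x => ‖g x‖ ^ p) := by
      simp only [hgp]
      exact (integrable_indicator_iff (hB n)).2
        (hind n _ (hmF.pow_const _) ⟨_, hbound hq0.le⟩)
    have hFg : ∀ x, F x * g x = (((B n).indicator (fun x => ‖F x‖ ^ q) x : ℝ) : ℂ) := fun x => by
      by_cases hx : x ∈ B n
      · simp only [g, Set.indicator_of_mem hx]
        rw [← mul_assoc, Complex.mul_conj', ← Complex.ofReal_pow, ← Complex.ofReal_mul,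
          ← Real.rpow_natCast, ← Real.rpow_add' (norm_nonneg _) (by push_cast; linarith)]
        congr 2; push_cast; ring
      · simp [g, Set.indicator_of_notMem hx]
    set I := ∫ x in B n, ‖F x‖ ^ q
    have hI0 : 0 ≤ I := integral_nonneg fun x => by positivity
    have hh := h g hgm hgi hgpi
    simp only [hFg, pnorm, hgp] at hh
    rw [integral_complex_ofReal, integral_indicator (hB n), Complex.norm_real,
      Real.norm_of_nonneg hI0] at hh
    rcases hI0.eq_or_lt' with h0 | hpos
    · rw [h0]; positivity
    have h1 : I ^ (1 / q) ≤ K := by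
      have e : I = I ^ (1 / q) * I ^ (1 / p) := by
        rw [← Real.rpow_add hpos]
        have := hpq.inv_add_inv_eq_one
        rw [one_div, one_div, add_comm, this, Real.rpow_one]
      have hpos' : 0 < I ^ (1 / p) := Real.rpow_pos_of_pos hpos _
      refine le_of_mul_le_mul_right ?_ hpos'
      rw [← e]; exact hh
    calc I = (I ^ (1 / q)) ^ q := by
          rw [← Real.rpow_mul hI0, one_div, inv_mul_cancel₀ hq0.ne', Real.rpow_one]
      _ ≤ K ^ q := Real.rpow_le_rpow (by positivity) h1 hq0.le
  have hl : ∫⁻ x, ‖F x‖ₑ ^ q ≤ ENNReal.ofReal (K ^ q) := by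
    have hcov : AECover (volume : Measure (Rd d)) atTop B :=
      aecover_ball tendsto_natCast_atTop_atTop
    refine le_of_tendsto (hcov.lintegral_tendsto_of_nat
      (hF.measurable.enorm.pow_const q).aemeasurable) (Eventually.of_forall fun n => ?_)
    refine le_trans (le_of_eq ?_) (ENNReal.ofReal_le_ofReal (key n))
    rw [ofReal_integral_eq_lintegral_ofReal (hind n _ (hmF.pow_const _) ⟨_, hbound hq0.le⟩)
      (Eventually.of_forall fun x => by positivity)]
    refine lintegral_congr fun x => ?_
    rw [← ofReal_norm, ENNReal.ofReal_rpow_of_nonneg (norm_nonneg _) hq0.le]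
  rw [eLpNorm_eq_lintegral_rpow_enorm_toReal (by simpa using hq0) ENNReal.ofReal_ne_top,
    ENNReal.toReal_ofReal hq0.le]
  calc _ ≤ (ENNReal.ofReal (K ^ q)) ^ (1 / q) := by gcongr
    _ = ENNReal.ofReal K := by
      rw [ENNReal.ofReal_rpow_of_nonneg (by positivity) (by positivity), ← Real.rpow_mul hK0,
        mul_one_div_cancel hq0.ne', Real.rpow_one]

end

/-! ### Extension to bounded operators. -/

section
variable {d : ℕ}

/-- A linear map on functions that is bounded from `L^p` to `L^q(ρ)` on `L^1 ∩ L^p` extends. -/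
theorem exists_continuousLinearMap_extension {ρ : Measure (Rd d)} {p q : ℝ≥0∞}
    [Fact (1 ≤ p)] [Fact (1 ≤ q)] (hp : p ≠ ⊤) {Φ : (Rd d → ℂ) → Rd d → ℂ} {C : ℝ}
    (hadd : ∀ f g, MemLp f 1 → MemLp g 1 → Φ (f + g) = Φ f + Φ g)
    (hsmul : ∀ (c : ℂ) f, Φ (c • f) = c • Φ f)
    (hb : ∀ f, MemLp f 1 → MemLp f p → MemLp (Φ f) q ρ ∧
      (eLpNorm (Φ f) q ρ).toReal ≤ C * (eLpNorm f p volume).toReal) :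
    ∃ S : Lp ℂ p (volume : Measure (Rd d)) →L[ℂ] Lp ℂ q ρ,
      (∀ (f : Rd d → ℂ) (_ : MemLp f 1 volume) (hf : MemLp f p volume),
        (S (hf.toLp f) : Rd d → ℂ) =ᵐ[ρ] Φ f) ∧ ∀ g, ‖S g‖ ≤ C * ‖g‖ := by
  let V : Submodule ℂ (Rd d → ℂ) :=
    { carrier := {f | MemLp f 1 volume ∧ MemLp f p volume}
      add_mem' := fun hf hg => ⟨hf.1.add hg.1, hf.2.add hg.2⟩
      zero_mem' := ⟨MemLp.zero', MemLp.zero'⟩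
      smul_mem' := fun c f hf => ⟨hf.1.const_smul c, hf.2.const_smul c⟩ }
  let e : V →ₗ[ℂ] Lp ℂ p (volume : Measure (Rd d)) :=
    { toFun := fun f => f.2.2.toLp f.1
      map_add' := fun f g => MemLp.toLp_add f.2.2 g.2.2
      map_smul' := fun c f => MemLp.toLp_const_smul c f.2.2 }
  let T : V →ₗ[ℂ] Lp ℂ q ρ :=
    { toFun := fun f => (hb f.1 f.2.1 f.2.2).1.toLp (Φ f.1)
      map_add' := fun f g => by
        rw [← MemLp.toLp_add]
        exact MemLp.toLp_congr _ _ (by rw [← hadd _ _ f.2.1 g.2.1]; rfl)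
      map_smul' := fun c f => by
        rw [RingHom.id_apply, ← MemLp.toLp_const_smul]
        exact MemLp.toLp_congr _ _ (by rw [← hsmul]; rfl) }
  -- Schwartz functions lie in `L¹ ∩ L^p` and are dense in `L^p` for finite `p`.
  have hdense : DenseRange e := by
    refine (SchwartzMap.denseRange_toLpCLM (E := Rd d) (F := ℂ) (μ := volume) hp).mono ?_
    rintro _ ⟨u, rfl⟩
    exact ⟨⟨u, u.memLp 1 volume, u.memLp p volume⟩, rfl⟩
  have hbd : ∀ f, ‖T f‖ ≤ C * ‖e f‖ := fun f => by
    simpa only [T, e, LinearMap.coe_mk, AddHom.coe_mk, Lp.norm_toLp] using (hb f.1 f.2.1 f.2.2).2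
  refine ⟨T.extendOfNorm e, fun f h1 hf => ?_, LinearMap.norm_extendOfNorm_apply_le hdense C hbd⟩
  have h := LinearMap.extendOfNorm_eq hdense ⟨C, hbd⟩ ⟨f, h1, hf⟩
  have h' : T.extendOfNorm e (hf.toLp f) = (hb f h1 hf).1.toLp (Φ f) := h
  rw [h']
  exact MemLp.coeFn_toLp _

theorem convOp_eq (ν : ComplexMeasure (Rd d)) (f : Rd d → ℂ) (x : Rd d) :
    convOp ν f x = ∫ y, f y * fourierCM ν (x - y) := by
  rw [convOp, ← integral_sub_left_eq_self _ volume x]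
  simp only [sub_sub_cancel]

theorem integrable_mul_fourierCM (ν : ComplexMeasure (Rd d)) {f : Rd d → ℂ} (hf : Integrable f)
    (x : Rd d) : Integrable fun y => f y * fourierCM ν (x - y) := by
  obtain ⟨c, hc⟩ := exists_norm_fourierCM_le ν
  exact hf.mul_bdd (c := c) ((continuous_fourierCM ν).comp
    (continuous_const.sub continuous_id)).aestronglyMeasurable (Eventually.of_forall fun _ => hc _)

theorem continuous_convOp (ν : ComplexMeasure (Rd d)) {f : Rd d → ℂ} (hf : Integrable f) :
    Continuous (convOp ν f) := by
  obtain ⟨c, hc⟩ := exists_norm_fourierCM_le ν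
  rw [show convOp ν f = fun x => ∫ y, f y * fourierCM ν (x - y) from funext (convOp_eq ν f)]
  refine continuous_of_dominated (bound := fun y => ‖f y‖ * c)
    (fun x => (integrable_mul_fourierCM ν hf x).1) (fun x => Eventually.of_forall fun y => ?_)
    (hf.norm.mul_const _) (Eventually.of_forall fun y => ?_)
  · rw [norm_mul]; exact mul_le_mul_of_nonneg_left (hc _) (norm_nonneg _)
  · exact continuous_const.mul ((continuous_fourierCM ν).comp (continuous_id.sub continuous_const))

theorem exists_norm_convOp_le (ν : ComplexMeasure (Rd d)) {f : Rd d → ℂ} (hf : Integrable f) :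
    ∃ L, ∀ x, ‖convOp ν f x‖ ≤ L := by
  obtain ⟨c, hc⟩ := exists_norm_fourierCM_le ν
  refine ⟨∫ y, ‖f y‖ * c, fun x => ?_⟩
  rw [convOp_eq]
  refine norm_integral_le_of_norm_le (hf.norm.mul_const _) (Eventually.of_forall fun y => ?_)
  rw [norm_mul]; exact mul_le_mul_of_nonneg_left (hc _) (norm_nonneg _)

theorem exists_measurable_ae_eq {p : ℝ≥0∞} (hp1 : 1 ≤ p) (hp : p ≠ ⊤) {f : Rd d → ℂ}
    (h1 : MemLp f 1) (hf : MemLp f p) :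
    ∃ g : Rd d → ℂ, f =ᵐ[volume] g ∧ Measurable g ∧ Integrable g ∧
      Integrable (fun x => ‖g x‖ ^ p.toReal) ∧
      pnorm p.toReal g = (eLpNorm f p volume).toReal := by
  have hae := hf.1.ae_eq_mk
  have hgp : MemLp (hf.1.mk f) p := (memLp_congr_ae hae).1 hf
  have hp0 : p ≠ 0 := (zero_lt_one.trans_le hp1).ne'
  refine ⟨hf.1.mk f, hae, hf.1.stronglyMeasurable_mk.measurable,
    memLp_one_iff_integrable.1 ((memLp_congr_ae hae).1 h1),
    (integrable_norm_rpow_iff hgp.1 hp0 hp).2 hgp, ?_⟩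
  rw [← eLpNorm_eq_pnorm hp1 hp hgp]
  exact congrArg ENNReal.toReal (eLpNorm_congr_ae hae.symm)

/-- For integrable `f` the function `f * ν̂` is bounded and continuous, so the converse Hölder
inequality turns the form bound, extended from test functions by truncation, into an `L^q` bound;
density then extends the operator. -/
theorem convBounded_of_norm_form_le {ν : ComplexMeasure (Rd d)} {p q : ℝ≥0∞} [Fact (1 ≤ p)]
    [Fact (1 ≤ q)] {K : ℝ} (hp1 : 1 < p) (hp2 : p < 2) (hpq : p⁻¹ + q⁻¹ = 1) (hK0 : 0 ≤ K)
    (hK : ∀ E, MeasurableSet E → volume E ≠ ⊤ → ∀ f g, IsTest E f → IsTest E g →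
      ‖form (fourierCM ν) f g‖ ≤ K * pnorm p.toReal f * pnorm p.toReal g) :
    ConvBounded ν p q K := by
  have hp : p ≠ ⊤ := (hp2.trans ENNReal.ofNat_lt_top).ne
  have hp0 : p ≠ 0 := (zero_lt_one.trans hp1).ne'
  have hq0 : q ≠ 0 := (zero_lt_one.trans_le (Fact.out : 1 ≤ q)).ne'
  have hpr : 1 < p.toReal := by simpa using (ENNReal.toReal_lt_toReal ENNReal.one_ne_top hp).2 hp1
  have hpr2 : p.toReal < 2 := by
    simpa using (ENNReal.toReal_lt_toReal hp ENNReal.ofNat_ne_top).2 hp2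
  have hadd : p.toReal⁻¹ + q.toReal⁻¹ = 1 := by
    rw [← ENNReal.toReal_inv, ← ENNReal.toReal_inv, ← ENNReal.toReal_add
      (ENNReal.inv_ne_top.2 hp0) (ENNReal.inv_ne_top.2 hq0), hpq, ENNReal.toReal_one]
  have hconj : p.toReal.HolderConjugate q.toReal := Real.holderConjugate_iff.2 ⟨hpr, hadd⟩
  have hqt : q ≠ ⊤ := fun h => by
    have := hconj.symm.pos
    rw [h] at this; simp at this
  have hq2 : 2 ≤ q.toReal := by
    have h1 : (2 : ℝ)⁻¹ ≤ p.toReal⁻¹ := inv_anti₀ (by linarith) hpr2.le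
    have h2 : q.toReal⁻¹ ≤ 2⁻¹ := by linarith
    exact (inv_le_inv₀ hconj.symm.pos two_pos).1 h2
  refine exists_continuousLinearMap_extension hp (fun f g hf hg => ?_) (fun c f => ?_)
    (fun f h1 hf => ?_)
  · ext x
    rw [Pi.add_apply, convOp_eq, convOp_eq, convOp_eq, ← integral_add
      (integrable_mul_fourierCM ν (memLp_one_iff_integrable.1 hf) x)
      (integrable_mul_fourierCM ν (memLp_one_iff_integrable.1 hg) x)]
    simp only [Pi.add_apply, add_mul]
  · ext x
    rw [Pi.smul_apply, convOp_eq, convOp_eq, ← integral_smul]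
    simp only [Pi.smul_apply, smul_eq_mul, mul_assoc]
  · obtain ⟨g, hfg, hgm, hgi, hgp, hgn⟩ := exists_measurable_ae_eq hp1.le hp h1 hf
    have hfun : convOp ν f = convOp ν g := by
      ext x
      rw [convOp_eq, convOp_eq]
      refine integral_congr_ae ?_
      filter_upwards [hfg] with y hy
      rw [hy]
    obtain ⟨L, hL⟩ := exists_norm_convOp_le ν hgi
    obtain ⟨c, hc⟩ := exists_norm_fourierCM_le ν
    have hcn : pnorm p.toReal (fun x => conj (g x)) = pnorm p.toReal g := by
      simp only [pnorm, RCLike.norm_conj]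
    have hbound := eLpNorm_le_of_forall_norm_integral_mul_le (continuous_convOp ν hgi) hL hconj hq2
      (mul_nonneg hK0 (pnorm_nonneg p.toReal g)) fun u hum hui hup => by
        have h := norm_form_le_of_isTest hconj.pos hK0 (continuous_fourierCM ν) hc hK
          (Complex.continuous_conj.measurable.comp hgm) (integrable_conj hgi)
          (by simpa [Function.comp_def] using hgp) hum hui hup
        rw [Function.comp_def, ← integral_convOp_mul ν (integrable_conj hgi) hui, hcn] at h
        simpa only [Complex.conj_conj] using h
    rw [ENNReal.ofReal_toReal hqt] at hbound
    rw [hfun, ← hgn]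
    exact ⟨⟨(continuous_convOp ν hgi).aestronglyMeasurable,
      hbound.trans_lt ENNReal.ofReal_lt_top⟩,
      ENNReal.toReal_le_of_le_ofReal (mul_nonneg hK0 (pnorm_nonneg _ _)) hbound⟩

theorem exists_restriction_operator {μ : Measure (Rd d)} [IsFiniteMeasure μ] {p : ℝ≥0∞}
    [Fact (1 ≤ p)] (hp : p ≠ ⊤) {M : ℝ} (hM0 : 0 ≤ M)
    (hM : ∀ E, MeasurableSet E → volume E ≠ ⊤ → IsRestrictionBound μ p.toReal E M) :
    ∃ R : Lp ℂ p (volume : Measure (Rd d)) →L[ℂ] Lp ℂ 2 μ,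
      (∀ (f : Rd d → ℂ) (_ : MemLp f 1 volume) (hf : MemLp f p volume),
        (R (hf.toLp f) : Rd d → ℂ) =ᵐ[μ] fourierFun f) ∧
      ∀ g, ∫ ξ, ‖R g ξ‖ ^ 2 ∂μ ≤ M * ‖g‖ ^ 2 := by
  have hp1 : 1 ≤ p := Fact.out
  have hext : ∃ R : Lp ℂ p (volume : Measure (Rd d)) →L[ℂ] Lp ℂ 2 μ,
      (∀ (f : Rd d → ℂ) (_ : MemLp f 1 volume) (hf : MemLp f p volume),
        (R (hf.toLp f) : Rd d → ℂ) =ᵐ[μ] fourierFun f) ∧ ∀ g, ‖R g‖ ≤ √M * ‖g‖ := by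
    refine exists_continuousLinearMap_extension hp (fun f g hf hg => ?_) (fun c f => ?_)
      (fun f h1 hf => ?_)
    · ext ξ
      have hf' := integrable_eChar_mul (memLp_one_iff_integrable.1 hf) ξ
      have hg' := integrable_eChar_mul (memLp_one_iff_integrable.1 hg) ξ
      rw [Pi.add_apply, fourierFun_eq, fourierFun_eq, fourierFun_eq, ← integral_add hf' hg']
      simp only [Pi.add_apply, mul_add]
    · ext ξ
      rw [Pi.smul_apply, fourierFun_eq, fourierFun_eq, ← integral_smul]
      simp only [Pi.smul_apply, smul_eq_mul, mul_left_comm]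
    · obtain ⟨g, hfg, hgm, hgi, hgp, hgn⟩ := exists_measurable_ae_eq hp1 hp h1 hf
      have hfun : fourierFun f = fourierFun g := by
        ext ξ
        rw [fourierFun_eq, fourierFun_eq]
        refine integral_congr_ae ?_
        filter_upwards [hfg] with y hy
        rw [hy]
      have hpr : 0 < p.toReal := ENNReal.toReal_pos (zero_lt_one.trans_le hp1).ne' hp
      have hbound := integral_norm_fourierFun_sq_le hpr hM0 hM hgm hgi hgp
      have hcont := continuous_fourierFun hgi
      have hmem : MemLp (fourierFun g) 2 μ :=
        (memLp_two_iff_integrable_sq_norm hcont.aestronglyMeasurable).2 (by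
          simpa using integrable_norm_fourierFun_sq_mul hgi (integrable_const (μ := μ) (1 : ℝ)))
      rw [hfun, ← hgn]
      refine ⟨hmem, ?_⟩
      rw [hmem.eLpNorm_eq_integral_rpow_norm two_ne_zero ENNReal.ofNat_ne_top,
        ENNReal.toReal_ofReal (by positivity)]
      simp only [ENNReal.toReal_ofNat, Real.rpow_ofNat]
      rw [← one_div, ← Real.sqrt_eq_rpow, ← Real.sqrt_sq (pnorm_nonneg p.toReal g),
        ← Real.sqrt_mul hM0]
      exact Real.sqrt_le_sqrt hbound
  obtain ⟨R, hR1, hR2⟩ := hext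
  refine ⟨R, hR1, fun g => ?_⟩
  have h : ∫ ξ, ‖R g ξ‖ ^ 2 ∂μ = ‖R g‖ ^ 2 := by
    have hmem := Lp.memLp (R g)
    rw [Lp.norm_def, hmem.eLpNorm_eq_integral_rpow_norm two_ne_zero ENNReal.ofNat_ne_top,
      ENNReal.toReal_ofReal (by positivity), ← Real.rpow_mul_natCast
      (integral_nonneg fun x => by positivity)]
    simp
  rw [h]
  calc ‖R g‖ ^ 2 ≤ (√M * ‖g‖) ^ 2 := pow_le_pow_left₀ (norm_nonneg _) (hR2 g) 2
    _ = M * ‖g‖ ^ 2 := by rw [mul_pow, Real.sq_sqrt hM0]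

/-- Replacing `φ j` by zero at `j = 0` and beyond `K` treats finite and infinite sums alike. The
geometric decay in `j` upgrades distributional convergence to pointwise convergence of Fourier
transforms. -/
theorem isDyadicSum_of_isDistribSum {μ : Measure (Rd d)} [IsFiniteMeasure μ] {A a b : ℝ}
    (hA : 0 ≤ A) (hb : 0 < b) {ν : ComplexMeasure (Rd d)} {K : ℕ∞} {φ : ℕ → Rd d → ℂ}
    (hν : IsDistribSum ν K (fun j => convDensity μ (φ j)))
    (hφ : ∀ j : ℕ, 1 ≤ j → (j : ℕ∞) ≤ K → Integrable (φ j) volume ∧ ∫ x, ‖φ j x‖ ≤ 1)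
    (hsup : ∀ j : ℕ, 1 ≤ j → (j : ℕ∞) ≤ K → eLpNorm (convDensity μ (φ j)) ⊤ volume
      ≤ ENNReal.ofReal (A * (2 : ℝ) ^ ((j : ℝ) * a)))
    (hdec : ∀ j : ℕ, 1 ≤ j → (j : ℕ∞) ≤ K → ∀ ξ : Rd d,
      ‖fourierFun (convDensity μ (φ j)) ξ‖ ≤ A * (2 : ℝ) ^ (-((j : ℝ) * b))) :
    IsDyadicSum μ A a b ν (fun j => if 1 ≤ j ∧ (j : ℕ∞) ≤ K then φ j else 0) := by
  classical
  have h1 : ∀ j : ℕ, Integrable (if 1 ≤ j ∧ (j : ℕ∞) ≤ K then φ j else 0) := fun j => by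
    split_ifs with h
    · exact (hφ j h.1 h.2).1
    · exact integrable_zero _ _ _
  have h4 : ∀ (j : ℕ) ξ, ‖fourierFun (convDensity μ
      (if 1 ≤ j ∧ (j : ℕ∞) ≤ K then φ j else 0)) ξ‖ ≤ A * 2 ^ (-(j * b)) := fun j ξ => by
    split_ifs with h
    · exact hdec j h.1 h.2 ξ
    · have : fourierFun (0 : Rd d → ℂ) ξ = 0 := by simp [fourierFun_eq]
      rw [convDensity_zero, this, norm_zero]; positivity
  refine ⟨h1, fun j => ?_, fun j => ?_, h4, ?_⟩
  · split_ifs with h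
    · exact (hφ j h.1 h.2).2
    · simp
  · split_ifs with h
    · have hs := hsup j h.1 h.2
      rw [eLpNorm_exponent_top] at hs
      filter_upwards [ae_le_eLpNormEssSup (f := convDensity μ (φ j)) (μ := volume)] with ξ hξ
      have h3 := hξ.trans hs
      rw [← ofReal_norm] at h3
      exact (ENNReal.ofReal_le_ofReal_iff (by positivity)).1 h3
    · refine Eventually.of_forall fun ξ => ?_
      rw [convDensity_zero, Pi.zero_apply, norm_zero]; positivity
  · refine hasSum_fourierCM ν (fun j => integrable_convDensity μ (h1 j))
      (summable_geometric_two_rpow hb A) h4 fun ψ hψ hψc => ?_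
    refine (hν ψ hψ hψc).congr fun n => ?_
    have : (Finset.Icc 1 n).filter (fun j : ℕ => (j : ℕ∞) ≤ K)
        = (Finset.range (n + 1)).filter (fun j : ℕ => 1 ≤ j ∧ (j : ℕ∞) ≤ K) := by
      ext j
      simp only [Finset.mem_filter, Finset.mem_Icc, Finset.mem_range, Nat.lt_succ_iff]
      tauto
    rw [this, Finset.sum_filter]
    refine Finset.sum_congr rfl fun j _ => ?_
    split_ifs with h
    · rfl
    · simp [convDensity_zero]

end

/-! ### The theorem. -/

theorem proposition5p1 (d : ℕ) (α β : ℝ) (hα : 0 < α) (hαβ : α ≤ β) (N : ℕ) :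
    ∃ C : ℝ, 0 < C ∧
      ∀ (p₀ q₀ : ℝ≥0∞) [Fact (1 ≤ p₀)] [Fact (1 ≤ q₀)], p₀ < 2 → p₀⁻¹ + q₀⁻¹ = 1 →
      ∀ (μ : Measure (Rd d)), μ Set.univ ≤ 1 →
      ∀ (μb : ComplexMeasure (Rd d)) (μi : Fin N → ComplexMeasure (Rd d)),
        (∀ s : Set (Rd d), MeasurableSet s → ((μ s).toReal : ℂ) = μb s + ∑ i, μi i s) →
      ∀ A : ℝ, 0 ≤ A →
        ConvBounded μb p₀ q₀ A →
      ∀ (K : Fin N → ℕ∞) (φ : Fin N → ℕ → Rd d → ℂ) (a b : Fin N → ℝ),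
        (∀ i, IsDistribSum (μi i) (K i) (fun j => convDensity μ (φ i j))) →
        (∀ i, ∀ j : ℕ, 1 ≤ j → (j : ℕ∞) ≤ K i →
          Integrable (φ i j) volume ∧ ∫ x, ‖φ i j x‖ ≤ 1) →
        (∀ i, a i ∈ Set.Icc α β ∧ b i ∈ Set.Icc α β) →
        (∀ i, ∀ j : ℕ, 1 ≤ j → (j : ℕ∞) ≤ K i →
          eLpNorm (convDensity μ (φ i j)) ∞ volume
            ≤ ENNReal.ofReal (A * (2 : ℝ) ^ ((j : ℝ) * a i))) →
        (∀ i, ∀ j : ℕ, 1 ≤ j → (j : ℕ∞) ≤ K i → ∀ ξ : Rd d,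
          ‖fourierFun (convDensity μ (φ i j)) ξ‖ ≤ A * (2 : ℝ) ^ (-((j : ℝ) * b i))) →
        (∀ i, p₀ = ENNReal.ofReal (2 * ((a i + b i) / (2 * a i + b i)))) →
        (∀ i, ConvBounded (μi i) p₀ q₀ (C * A)) ∧
        ∃ R : Lp ℂ p₀ (volume : Measure (Rd d)) →L[ℂ] Lp ℂ 2 μ,
          (∀ (f : Rd d → ℂ) (_ : MemLp f 1 volume) (hf : MemLp f p₀ volume),
            (R (hf.toLp f) : Rd d → ℂ) =ᵐ[μ] fourierFun f) ∧
          ∀ g, ∫ ξ, ‖R g ξ‖ ^ 2 ∂μ ≤ C * A * ‖g‖ ^ 2 := by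
  set r := restrConst d N α β with hr
  set c := formConst d α β with hc
  have hr1 : 1 ≤ r := by
    rw [hr, restrConst]; nlinarith [sq_nonneg ((N : ℝ) * formConst d α β)]
  have hr0 : 0 ≤ r := zero_le_one.trans hr1
  have hc0 : 0 ≤ c := formConst_nonneg d α β
  -- The summand `r` serves the restriction estimate. Inserting `M = rA` into `c √(A M)` gives `c √r
  -- A`, which serves the operators `T_{μ^i}`.
  refine ⟨r + c * √r, by positivity, ?_⟩
  intro p q _ _ hp2 hpq μ hμ μb μi hsum A hA hμb K φ a b hdist hφ hab hsup hdec hpab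
  have : IsFiniteMeasure μ := ⟨hμ.trans_lt ENNReal.one_lt_top⟩
  have hp : p ≠ ⊤ := (hp2.trans ENNReal.ofNat_lt_top).ne
  have ha0 : ∀ i, 0 < a i := fun i => hα.trans_le (hab i).1.1
  have hb0 : ∀ i, 0 < b i := fun i => hα.trans_le (hab i).2.1
  have hpr : ∀ i, p.toReal = 2 * ((a i + b i) / (2 * a i + b i)) := fun i => by
    have h1 := ha0 i
    have h2 := hb0 i
    rw [hpab i, ENNReal.toReal_ofReal (by positivity)]
  have hi := fun i =>
    isDyadicSum_of_isDistribSum hA (hb0 i) (hdist i) (hφ i) (hsup i) (hdec i)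
  have hM : ∀ E, MeasurableSet E → volume E ≠ ⊤ → IsRestrictionBound μ p.toReal E (r * A) :=
    fun E hE hE' => isRestrictionBound_restrConst hα hp hpq hμ hsum hA hμb hab hpr hi hE hE'
  have hrA : r * A ≤ (r + c * √r) * A :=
    mul_le_mul_of_nonneg_right (le_add_of_nonneg_right (by positivity)) hA
  refine ⟨fun i => ?_, exists_restriction_operator hp (by positivity) fun E hE hE' g hg =>
    (hM E hE hE' g hg).trans (mul_le_mul_of_nonneg_right hrA (by positivity))⟩
  -- The formula for `p` excludes the endpoint `p = 1` as soon as there is an index `i`; for `N = 0`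
  -- only the restriction estimate has content.
  have hp1 : 1 < p := by
    have h1 := ha0 i
    have h2 := hb0 i
    rw [hpab i, ENNReal.one_lt_ofReal, ← mul_div_assoc, one_lt_div (by positivity)]
    linarith
  refine convBounded_of_norm_form_le hp1 hp2 hpq (by positivity) fun E hE hE' f g hf hg => ?_
  refine ((hi i).norm_form_le hα (hab i).1 (hab i).2 (hpr i) hA
    (le_mul_of_one_le_left hA hr1) hE hE' (hM E hE hE') hf hg).trans ?_
  have hs : √(A * (r * A)) = √r * A := by
    rw [show A * (r * A) = r * A ^ 2 by ring, Real.sqrt_mul hr0, Real.sqrt_sq hA]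
  rw [hs]
  have h1 := pnorm_nonneg p.toReal f
  have h2 := pnorm_nonneg p.toReal g
  refine mul_le_mul_of_nonneg_right (mul_le_mul_of_nonneg_right ?_ h1) h2
  rw [← mul_assoc]
  exact mul_le_mul_of_nonneg_right (le_add_of_nonneg_left hr0) hA
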